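/- Let $E$ be a Polish space, let $d_E$ be a complete metric inducing its topology, and let $x_*\in E$. Adjoin to $E$ an isolated cemetery state $\triangle$ and put $\bar E:=E\cup\{\triangle\}$. Let $\Omega$ be the set of all paths $\omega:[0,\infty)\to\bar E$ with $\omega_0=x_*$ that are càdlàg on $[0,\zeta(\omega))$ and constant on $[\zeta(\omega),\infty)$, where $\zeta(\omega):=\inf\{t\ge 0:\omega_t=\triangle\}\in(0,\infty]$ and $\inf\emptyset:=\infty$. Let $B_t(\omega):=\omega_t$ be the canonical process, $\mathcal F_t:=\sigma(B_s,\,s\le t)$, $\mathbb F:=(\mathcal F_t)_{t\ge0}$, and $\mathcal F:=\sigma(B_s,\,s\ge 0)$. Let $\mathbb D$ be the space of càdlàg paths $x:[0,\infty)\to E$ with $x(0)=x_*$, equipped with the Skorokhod metric $$\delta_\infty(x,y):=\inf_{\lambda}\ \max\Big\{\gamma(\lambda),\ \int_0^\infty e^{-u}\,\sup_{t\ge0}\big(1\wedge d_E\big(x(t\wedge u),\,y(\lambda(t)\wedge u)\big)\big)\,du\Big\},\qquad \gamma(\lambda):=\sup_{0\le s<t}\Big|\log\frac{\lambda(t)-\lambda(s)}{t-s}\Big|,$$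 where $\lambda$ runs over the increasing bijections of $[0,\infty)$ (those with $\gamma(\lambda)=\infty$ do not contribute). For $z\in(0,\infty]$ let $e_z:[0,\infty)\to[0,z)$ be given by $e_\infty(t):=t$ and $e_z(t):=z(1-e^{-t})$ for $z<\infty$; then $\omega\circ e_{\zeta(\omega)}\in\mathbb D$ for all $\omega\in\Omega$. Define, with $\infty^{-1}:=0$, $$\delta_\Omega(\omega,\omega'):=\big|\zeta(\omega)^{-1}-\zeta(\omega')^{-1}\big|+\delta_\infty\big(\omega\circ e_{\zeta(\omega)},\,\omega'\circ e_{\zeta(\omega')}\big),\qquad \omega,\omega'\in\Omega.$$ Then $\delta_\Omega$ is a metric on $\Omega$, the space $(\Omega,\delta_\Omega)$ is complete and separable (in particular Polish), and its Borel $\sigma$-field coincides with $\mathcal F$. Moreover, for every $\mathbb F$-stopping time $\tau:\Omega\to[0,\infty]$, the $\sigma$-field $\mathcal F_\tau:=\{A\in\mathcal F:\ A\cap\{\tau\le t\}\in\mathcal F_t\text{ for all }t\ge0\}$ satisfies $\mathcal F_\tau=\sigma(B_{t\wedge\tau},\,t\ge0)$; in particular, $\mathcal F_\tau$ is countably generated.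 -/

import Mathlib

open Set Filter Topology MeasureTheory
open scoped NNReal ENNReal

noncomputable section

namespace KilledPaths

/-- A path `f : [0, ∞) → F` is càdlàg at `t`: right-continuous at `t`, with a left limit at `t`
(the latter is a void requirement for `t = 0`). -/
def CadlagAt {F : Type*} [TopologicalSpace F] (f : ℝ≥0 → F) (t : ℝ≥0) : Prop :=
  ContinuousWithinAt f (Ioi t) t ∧ ∃ l : F, Tendsto f (𝓝[<] t) (𝓝 l)

/-! ### The Skorokhod space -/

/-- The space of càdlàg paths `[0, ∞) → E` starting at `x₀`. -/
structure SkorokhodPath {E : Type*} [TopologicalSpace E] (x₀ : E) where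
  toFun : ℝ≥0 → E
  map_zero' : toFun 0 = x₀
  cadlag' : ∀ t, CadlagAt toFun t

instance {E : Type*} [TopologicalSpace E] (x₀ : E) :
    CoeFun (SkorokhodPath x₀) (fun _ => ℝ≥0 → E) :=
  ⟨SkorokhodPath.toFun⟩

/-- `γ(l) = sup_{s < t} |log ((l t - l s) / (t - s))|` for a time change `l`, that is, an increasing
bijection of `[0, ∞)`. -/
def logSlope (l : ℝ≥0 ≃o ℝ≥0) : ℝ≥0∞ :=
  ⨆ (s : ℝ≥0) (t : ℝ≥0) (_ : s < t),
    ENNReal.ofReal |Real.log (((l t : ℝ) - (l s : ℝ)) / ((t : ℝ) - (s : ℝ)))|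

/-- `sup_{t ≥ 0} 1 ∧ d_E (x (t ∧ u), y (l t ∧ u))`. -/
def stoppedSupDist {E : Type*} [MetricSpace E] (x y : ℝ≥0 → E) (l : ℝ≥0 ≃o ℝ≥0) (u : ℝ≥0) :
    ℝ≥0∞ :=
  ⨆ t : ℝ≥0, min 1 (edist (x (min t u)) (y (min (l t) u)))

/-- The usual (complete) Skorokhod metric on the càdlàg paths in a metric space,
`inf_l max (γ(l)) (∫₀^∞ e^{-u} sup_t (1 ∧ d_E (x (t ∧ u), y (l t ∧ u))) du)`, where `l` runs over
the time changes (those with `γ(l) = ∞` do not contribute). The infimum is at most `1`, as one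
sees from `l = id`. -/
def skorokhodDist {E : Type*} [MetricSpace E] {x₀ : E} (x y : SkorokhodPath x₀) : ℝ :=
  (⨅ l : ℝ≥0 ≃o ℝ≥0, max (logSlope l)
    (∫⁻ u in Ioi (0 : ℝ), ENNReal.ofReal (Real.exp (-u)) * stoppedSupDist x y l u.toNNReal)).toReal

/-! ### The space of killed paths -/

/-- The state space `E` with an isolated cemetery state adjoined (with the topology of the
disjoint union). -/
abbrev WithCemetery (E : Type*) := E ⊕ Unit

/-- The cemetery state. -/
abbrev cemetery {E : Type*} : WithCemetery E := Sum.inr ()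

/-- The lifetime `inf {t ≥ 0 : ω t = cemetery}`, with `inf ∅ = ∞`. -/
def lifetime {E : Type*} (ω : ℝ≥0 → WithCemetery E) : ℝ≥0∞ :=
  ⨅ (t : ℝ≥0) (_ : ω t = cemetery), (t : ℝ≥0∞)

/-- The space `Ω` of killed càdlàg paths starting at `x₀`. -/
structure KilledPath {E : Type*} [TopologicalSpace E] (x₀ : E) where
  toFun : ℝ≥0 → WithCemetery E
  map_zero' : toFun 0 = Sum.inl x₀
  cadlag' : ∀ t : ℝ≥0, (t : ℝ≥0∞) < lifetime toFun →
    CadlagAt toFun t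
  const' : ∀ s t : ℝ≥0, lifetime toFun ≤ s → lifetime toFun ≤ t → toFun s = toFun t

instance {E : Type*} [TopologicalSpace E] (x₀ : E) :
    CoeFun (KilledPath x₀) (fun _ => ℝ≥0 → WithCemetery E) :=
  ⟨KilledPath.toFun⟩

section

variable {E : Type*} [TopologicalSpace E] {x₀ : E}

theorem lifetime_pos (ω : KilledPath x₀) : 0 < lifetime ω := by
  by_contra h
  have h0 : lifetime ω = 0 := by simpa using h
  have hne : lifetime ω ≠ ⊤ := by simp [h0]
  have : ∃ t, ω t = cemetery := by
    by_contra hc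
    push Not at hc
    exact hne (by simp [lifetime, hc])
  obtain ⟨t, ht⟩ := this
  have h1 := ω.const' 0 t (by rw [h0]; exact zero_le) (by rw [h0]; exact zero_le)
  rw [ω.map_zero', ht] at h1
  cases h1

theorem exists_inl_of_lt_lifetime (ω : KilledPath x₀) {t : ℝ≥0} (ht : (t : ℝ≥0∞) < lifetime ω) :
    ∃ x : E, ω t = Sum.inl x := by
  rcases h : ω t with x | ⟨⟩
  · exact ⟨x, rfl⟩
  · exact absurd (iInf₂_le t h) (not_le.2 ht)

end

/-- The time change `e_z : [0, ∞) → [0, z)`: the identity if `z = ∞`, and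
`t ↦ z (1 - exp (-t))` if `z < ∞`. -/
def timeScale (z : ℝ≥0∞) (t : ℝ≥0) : ℝ≥0 :=
  if z = ∞ then t else z.toNNReal * (1 - Real.exp (-(t : ℝ))).toNNReal

theorem timeScale_zero (z : ℝ≥0∞) : timeScale z 0 = 0 := by
  simp [timeScale]

theorem continuous_timeScale (z : ℝ≥0∞) : Continuous (timeScale z) := by
  unfold timeScale
  split_ifs
  · exact continuous_id
  · fun_prop

theorem timeScale_lt {z : ℝ≥0∞} (hz : 0 < z) (t : ℝ≥0) : (timeScale z t : ℝ≥0∞) < z := by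
  unfold timeScale
  split_ifs with h
  · simp [h]
  · lift z to ℝ≥0 using h
    have hz' : 0 < z := by exact_mod_cast hz
    have h1 : (1 - Real.exp (-(t : ℝ))).toNNReal < 1 := by
      rw [Real.toNNReal_lt_one]
      linarith [Real.exp_pos (-(t : ℝ))]
    have h2 := mul_lt_mul_of_pos_left h1 hz'
    rw [mul_one] at h2
    simpa using (ENNReal.coe_lt_coe.2 h2)

theorem strictMono_timeScale {z : ℝ≥0∞} (hz : 0 < z) : StrictMono (timeScale z) := by
  intro s t hst
  unfold timeScale
  split_ifs with h
  · exact hst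
  · lift z to ℝ≥0 using h
    have hz' : 0 < z := by exact_mod_cast hz
    refine mul_lt_mul_of_pos_left ?_ (by simpa using hz')
    have hst' : (s : ℝ) < t := by exact_mod_cast hst
    have h1 : Real.exp (-(t : ℝ)) < Real.exp (-(s : ℝ)) := Real.exp_lt_exp.2 (by linarith)
    have h2 : Real.exp (-(s : ℝ)) ≤ 1 := by
      rw [Real.exp_le_one_iff]; linarith [s.2]
    exact (Real.toNNReal_lt_toNNReal_iff (by linarith)).2 (by linarith)

/-- The `E`-component of a point of `E ∪ {cemetery}`, with the value `x₀` at the cemetery. -/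
def stateOr {E : Type*} (x₀ : E) : WithCemetery E → E := Sum.elim id (fun _ => x₀)

theorem continuous_stateOr {E : Type*} [TopologicalSpace E] (x₀ : E) :
    Continuous (stateOr x₀) :=
  continuous_id.sumElim continuous_const

/-- The path `ω ∘ e_{ζ(ω)}`, an element of the Skorokhod space. It never meets the cemetery, so
that the default value of `stateOr` is never used, see `inl_rescale`. -/
def rescale {E : Type*} [TopologicalSpace E] {x₀ : E} (ω : KilledPath x₀) : SkorokhodPath x₀ where
  toFun t := stateOr x₀ (ω (timeScale (lifetime ω) t))
  map_zero' := by simp [timeScale_zero, ω.map_zero', stateOr]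
  cadlag' t := by
    have hz := lifetime_pos ω
    have hm := strictMono_timeScale hz
    have hc := (continuous_timeScale (lifetime ω)).tendsto t
    obtain ⟨hr, l, hl⟩ := ω.cadlag' _ (timeScale_lt hz t)
    refine ⟨?_, stateOr x₀ l, ?_⟩
    · refine ((continuous_stateOr x₀).tendsto _).comp (hr.tendsto.comp ?_)
      exact tendsto_nhdsWithin_iff.2 ⟨hc.mono_left nhdsWithin_le_nhds,
        eventually_nhdsWithin_of_forall fun s hs => hm hs⟩
    · refine ((continuous_stateOr x₀).tendsto _).comp (hl.comp ?_)
      exact tendsto_nhdsWithin_iff.2 ⟨hc.mono_left nhdsWithin_le_nhds,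
        eventually_nhdsWithin_of_forall fun s hs => hm hs⟩

theorem inl_rescale {E : Type*} [TopologicalSpace E] {x₀ : E} (ω : KilledPath x₀) (t : ℝ≥0) :
    (Sum.inl (rescale ω t) : WithCemetery E) = ω (timeScale (lifetime ω) t) := by
  obtain ⟨x, hx⟩ := exists_inl_of_lt_lifetime ω (timeScale_lt (lifetime_pos ω) t)
  simp [rescale, hx, stateOr]

/-- The distance `δ_Ω (ω, ω') = |ζ(ω)⁻¹ - ζ(ω')⁻¹| + δ_∞ (ω ∘ e_{ζ(ω)}, ω' ∘ e_{ζ(ω')})`, where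
`∞⁻¹ = 0`. -/
def killedDist {E : Type*} [MetricSpace E] {x₀ : E} (ω ω' : KilledPath x₀) : ℝ :=
  |(lifetime ω)⁻¹.toReal - (lifetime ω')⁻¹.toReal| + skorokhodDist (rescale ω) (rescale ω')

/-! ### The canonical process and its σ-fields -/

/-- The σ-field on `Ω` generated by a family of maps `X i : Ω → F`, where `F` carries its Borel
σ-field. -/
abbrev generatedSigma {Ω F ι : Type*} [TopologicalSpace F] (X : ι → Ω → F) : MeasurableSpace Ω :=
  ⨆ i, (borel F).comap (X i)

/-- The canonical process `B_t(ω) = ω t`. -/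
def canonicalProcess {E : Type*} [TopologicalSpace E] (x₀ : E) (t : ℝ≥0) (ω : KilledPath x₀) :
    WithCemetery E :=
  ω t

/-- The canonical σ-field `ℱ = σ(B_s, s ≥ 0)`. -/
abbrev canonicalSigma {E : Type*} [TopologicalSpace E] (x₀ : E) : MeasurableSpace (KilledPath x₀) :=
  generatedSigma (canonicalProcess x₀)

/-- The natural filtration `ℱ_t = σ(B_s, s ≤ t)`. -/
def canonicalFiltration {E : Type*} [TopologicalSpace E] (x₀ : E) :
    Filtration ℝ≥0 (canonicalSigma x₀) where
  seq t := generatedSigma (fun s : Iic t => canonicalProcess x₀ s)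
  mono' _ _ h := iSup_le fun s => le_iSup_of_le ⟨s.1, s.2.trans h⟩ le_rfl
  le' _ := iSup_le fun s => le_iSup_of_le s.1 le_rfl

end KilledPaths

end

/-!
The space `Ω` of killed paths is in bijection with `[0, ∞) × 𝔻`, where `𝔻` is the Skorokhod space,
by sending a path to its inverse lifetime and its rescaling to `[0, ∞)`, and `δ_Ω` is the `ℓ¹`
distance of that product (`killedPathCode`, `killedPathCode_surjective`). So completeness and
separability of `Ω` reduce to those of `𝔻`.

On `𝔻`, convergence follows from the criterion `tendsto_of_timeChange`: it suffices to match the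
paths by time changes with slopes tending to `1`, uniformly on bounded intervals. The integral in the
metric then tends to `0` by dominated convergence, since the integrand converges at each continuity
point of the limit, and a càdlàg path has at most countably many discontinuities. For completeness,
the time changes between consecutive paths of a fast Cauchy sequence are composed; the compositions
converge (`exists_limit_iterTimeChange`), and after these time changes the paths converge uniformly
on bounded intervals. For separability, càdlàg paths are approximated by step functions, whose jumps
are moved into a countable dense set by a time change close to the identity
(`exists_timeChange_mem_dense`, `exists_stepPath_dist_lt`).

The canonical process is Borel measurable: on `𝔻`, the set of paths with values in a closed set
during an open time interval is closed, and right-continuity gives the values at fixed times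
(`measurable_skorokhodPath_apply`) and at measurable times (`measurable_eval_of_rightContinuous`).
Conversely, countably many coordinates embed the Polish space `Ω` measurably and injectively into a
countable product, so that by the Lusin-Souslin theorem they generate the whole Borel σ-field
(`borel_killedPath_eq`).

For a stopping time `τ`, the argument is Galmarino's. The σ-field `ℱ_t` is the preimage of `ℱ` under
stopping at `t` (`canonicalFiltration_eq_comap`). Hence an event of `ℱ_τ` is its own preimage under
stopping at `τ` (`stopAtTime_preimage_eq`), and so lies in the σ-field of the stopped process, which
is the preimage of `ℱ` under this map. The stopped process is `ℱ_τ`-measurable because an event of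
`ℱ` that is invariant under stopping at `t` lies in `ℱ_t`.
-/

noncomputable section

namespace KilledPaths


/-! ### Right-continuous functions -/

/-- Membership of a right-continuous function in an open set can be read off from its values at
the times of a dense set just after the given time. -/
theorem mem_open_iff_of_rightContinuous {F : Type*} [TopologicalSpace F]
    [SecondCountableTopology F] [RegularSpace F] {D : Set ℝ≥0} (hD : Dense D) {f : ℝ≥0 → F}
    {t : ℝ≥0} (hf : ContinuousWithinAt f (Ioi t) t) {G : Set F} (hG : IsOpen G) :
    f t ∈ G ↔ ∃ b ∈ {b ∈ TopologicalSpace.countableBasis F | closure b ⊆ G}, ∃ m : ℕ,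
      ∀ s ∈ D, t < s → s < t + 1 / (m + 1) → f s ∈ closure b := by
  constructor
  · intro h
    obtain ⟨b, hb, htb, hbG⟩ := (TopologicalSpace.isBasis_countableBasis F).exists_closure_subset
      (hG.mem_nhds h)
    refine ⟨b, ⟨hb, hbG⟩, ?_⟩
    have hb' : b ∈ 𝓝 (f t) := (TopologicalSpace.isOpen_of_mem_countableBasis hb).mem_nhds htb
    obtain ⟨u, hu, hub⟩ := mem_nhdsGT_iff_exists_Ioo_subset.1 (hf hb')
    have hut : (0 : ℝ≥0) < u - t := tsub_pos_of_lt hu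
    obtain ⟨m, hm⟩ := exists_nat_one_div_lt hut
    refine ⟨m, fun s _ hts hsm => subset_closure (hub ⟨hts, hsm.trans ?_⟩)⟩
    calc t + 1 / (m + 1) < t + (u - t) := by gcongr
      _ = u := add_tsub_cancel_of_le (le_of_lt hu)
  · rintro ⟨b, ⟨-, hbG⟩, m, hm⟩
    have hlt : t < t + 1 / ((m : ℝ≥0) + 1) := lt_add_of_pos_right _ (by positivity)
    obtain ⟨u, -, hu, hut⟩ := hD.exists_seq_strictAnti_tendsto_of_lt hlt
    refine hbG (isClosed_closure.mem_of_tendsto (hf.tendsto.comp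
      (tendsto_nhdsWithin_iff.2 ⟨hut, Eventually.of_forall fun n => (hu n).1.1⟩))
      (Eventually.of_forall fun n => hm _ (hu n).2 (hu n).1.1 (hu n).1.2))

/-- A right-continuous process, sampled at a random time, is measurable. -/
theorem measurable_eval_of_rightContinuous {Ω F : Type*} [MeasurableSpace Ω] [TopologicalSpace F]
    [SecondCountableTopology F] [RegularSpace F] [MeasurableSpace F] [BorelSpace F]
    {X : ℝ≥0 → Ω → F} (hX : ∀ t, Measurable (X t))
    (hr : ∀ ω t, ContinuousWithinAt (fun s => X s ω) (Ioi t) t) {σ : Ω → ℝ≥0}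
    (hσ : Measurable σ) : Measurable fun ω => X (σ ω) ω := by
  obtain ⟨D, hDc, hD⟩ := TopologicalSpace.exists_countable_dense ℝ≥0
  refine measurable_of_isOpen fun G hG => ?_
  have : (fun ω => X (σ ω) ω) ⁻¹' G =
      ⋃ b ∈ {b ∈ TopologicalSpace.countableBasis F | closure b ⊆ G}, ⋃ m : ℕ, ⋂ s ∈ D,
        {ω | σ ω < s → s < σ ω + 1 / (m + 1) → X s ω ∈ closure b} := by
    ext ω
    simp only [mem_preimage, mem_open_iff_of_rightContinuous hD (hr ω (σ ω)) hG, mem_iUnion,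
      mem_iInter, mem_ofPred_eq, exists_prop]
  rw [this]
  refine MeasurableSet.biUnion ((TopologicalSpace.countable_countableBasis F).mono fun _ h => h.1)
    fun b _ => MeasurableSet.iUnion fun m => MeasurableSet.biInter hDc fun s _ => ?_
  exact (measurableSet_lt hσ measurable_const).imp ((measurableSet_lt measurable_const
    (hσ.add_const _)).imp (hX s isClosed_closure.measurableSet))

theorem measurable_of_rightContinuous {F : Type*} [TopologicalSpace F]
    [SecondCountableTopology F] [RegularSpace F] [MeasurableSpace F] [BorelSpace F]
    {f : ℝ≥0 → F} (hf : ∀ t, ContinuousWithinAt f (Ioi t) t) : Measurable f :=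
  measurable_eval_of_rightContinuous (X := fun t _ => f t) (fun _ => measurable_const)
    (fun _ => hf) measurable_id

theorem eq_of_rightContinuous_of_dense {F : Type*} [TopologicalSpace F] [T2Space F]
    {f g : ℝ≥0 → F} (hf : ∀ t, ContinuousWithinAt f (Ioi t) t)
    (hg : ∀ t, ContinuousWithinAt g (Ioi t) t) {D : Set ℝ≥0} (hD : Dense D)
    (h : ∀ t ∈ D, f t = g t) : f = g := by
  ext t
  obtain ⟨u, -, hu, hut⟩ := hD.exists_seq_strictAnti_tendsto t
  have hut' : Tendsto u atTop (𝓝[>] t) :=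
    tendsto_nhdsWithin_iff.2 ⟨hut, Eventually.of_forall fun n => (hu n).1⟩
  refine tendsto_nhds_unique ((hf t).tendsto.comp hut') ?_
  refine ((hg t).tendsto.comp hut').congr fun n => (h _ (hu n).2).symm

/-- Right-continuity is preserved under precomposition with a continuous monotone function: the
inner function may be locally constant, but it never reaches a point from the left. -/
theorem rightContinuous_comp {F : Type*} [TopologicalSpace F] {f : ℝ≥0 → F}
    (hf : ∀ t, ContinuousWithinAt f (Ioi t) t) {g : ℝ≥0 → ℝ≥0} (hg : Monotone g)
    (hgc : Continuous g) (t : ℝ≥0) : ContinuousWithinAt (fun s => f (g s)) (Ioi t) t := by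
  have h : ContinuousWithinAt f (Ici (g t)) (g t) := by
    rw [← Ioi_insert]
    exact continuousWithinAt_insert_self.2 (hf _)
  exact ContinuousWithinAt.comp (t := Ici (g t)) h hgc.continuousWithinAt
    fun s hs => hg (le_of_lt hs)

theorem CadlagAt.comp_strictMono {F : Type*} [TopologicalSpace F] {f : ℝ≥0 → F} {g : ℝ≥0 → ℝ≥0}
    {t : ℝ≥0} (hf : CadlagAt f (g t)) (hg : StrictMono g) (hgc : Continuous g) :
    CadlagAt (fun s => f (g s)) t := by
  obtain ⟨hr, l, hl⟩ := hf
  refine ⟨hr.tendsto.comp ?_, l, hl.comp ?_⟩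
  · exact tendsto_nhdsWithin_iff.2 ⟨(hgc.tendsto t).mono_left nhdsWithin_le_nhds,
      eventually_nhdsWithin_of_forall fun s hs => hg hs⟩
  · exact tendsto_nhdsWithin_iff.2 ⟨(hgc.tendsto t).mono_left nhdsWithin_le_nhds,
      eventually_nhdsWithin_of_forall fun s hs => hg hs⟩

/-! ### Time changes -/

/-- The slopes of `l` lie between `exp (-a)` and `exp a`. -/
def SlopeBound (l : ℝ≥0 → ℝ≥0) (a : ℝ) : Prop :=
  ∀ s t : ℝ≥0, s ≤ t → Real.exp (-a) * ((t : ℝ) - s) ≤ (l t : ℝ) - l s ∧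
    (l t : ℝ) - l s ≤ Real.exp a * ((t : ℝ) - s)

theorem logSlope_le_iff {l : ℝ≥0 ≃o ℝ≥0} {a : ℝ} (ha : 0 ≤ a) :
    logSlope l ≤ ENNReal.ofReal a ↔ SlopeBound l a := by
  have key : ∀ s t : ℝ≥0, s < t →
      (|Real.log (((l t : ℝ) - (l s : ℝ)) / ((t : ℝ) - (s : ℝ)))| ≤ a ↔
        Real.exp (-a) * ((t : ℝ) - s) ≤ (l t : ℝ) - l s ∧
        (l t : ℝ) - l s ≤ Real.exp a * ((t : ℝ) - s)) := by
    intro s t hst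
    have h1 : (0 : ℝ) < t - s := sub_pos.2 (by exact_mod_cast hst)
    have h2 : (0 : ℝ) < l t - l s := sub_pos.2 (by exact_mod_cast l.strictMono hst)
    rw [abs_le, Real.le_log_iff_exp_le (by positivity), Real.log_le_iff_le_exp (by positivity),
      le_div_iff₀ h1, div_le_iff₀ h1]
  simp only [logSlope, iSup_le_iff, ENNReal.ofReal_le_ofReal_iff ha]
  constructor
  · intro h s t hst
    rcases hst.eq_or_lt with rfl | hst
    · simp
    · exact (key s t hst).1 (h s t hst)
  · exact fun h s t hst => (key s t hst).2 (h s t hst.le)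

theorem SlopeBound.comp {l m : ℝ≥0 → ℝ≥0} {a b : ℝ} (hl : SlopeBound l a) (hlm : Monotone l)
    (hm : SlopeBound m b) : SlopeBound (m ∘ l) (a + b) := by
  intro s t hst
  obtain ⟨h1, h2⟩ := hl s t hst
  obtain ⟨h3, h4⟩ := hm _ _ (hlm hst)
  rw [neg_add_rev, Real.exp_add, add_comm a b, Real.exp_add, mul_assoc, mul_assoc]
  exact ⟨(mul_le_mul_of_nonneg_left h1 (Real.exp_pos _).le).trans h3,
    h4.trans (mul_le_mul_of_nonneg_left h2 (Real.exp_pos _).le)⟩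

theorem SlopeBound.symm {l : ℝ≥0 ≃o ℝ≥0} {a : ℝ} (hl : SlopeBound l a) :
    SlopeBound l.symm a := by
  intro s t hst
  obtain ⟨h1, h2⟩ := hl _ _ (l.symm.monotone hst)
  simp only [OrderIso.apply_symm_apply] at h1 h2
  have h : Real.exp (-a) * Real.exp a = 1 := by rw [← Real.exp_add]; simp
  constructor
  · calc _ ≤ Real.exp (-a) * (Real.exp a * ((l.symm t : ℝ) - l.symm s)) :=
          mul_le_mul_of_nonneg_left h2 (Real.exp_pos _).le
      _ = _ := by rw [← mul_assoc, h, one_mul]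
  · calc _ = Real.exp a * (Real.exp (-a) * ((l.symm t : ℝ) - l.symm s)) := by
          rw [← mul_assoc, mul_comm (Real.exp a), h, one_mul]
      _ ≤ _ := mul_le_mul_of_nonneg_left h1 (Real.exp_pos _).le

theorem SlopeBound.mono {l : ℝ≥0 → ℝ≥0} {a b : ℝ} (hl : SlopeBound l a) (hab : a ≤ b) :
    SlopeBound l b := by
  intro s t hst
  have h0 : (0 : ℝ) ≤ t - s := sub_nonneg.2 (by exact_mod_cast hst)
  exact ⟨(mul_le_mul_of_nonneg_right (Real.exp_le_exp.2 (neg_le_neg hab)) h0).trans (hl s t hst).1,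
    (hl s t hst).2.trans (mul_le_mul_of_nonneg_right (Real.exp_le_exp.2 hab) h0)⟩

theorem SlopeBound.le_exp_mul {l : ℝ≥0 → ℝ≥0} {a : ℝ} (hl : SlopeBound l a) (h0 : l 0 = 0)
    (t : ℝ≥0) : (l t : ℝ) ≤ Real.exp a * t := by
  simpa [h0] using (hl 0 t zero_le).2

theorem SlopeBound.dist_le {l : ℝ≥0 → ℝ≥0} {a : ℝ} (hl : SlopeBound l a)
    (h0 : l 0 = 0) (t : ℝ≥0) : dist (l t) t ≤ (Real.exp a - 1) * t := by
  obtain ⟨h1, h2⟩ := hl 0 t zero_le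
  simp only [h0, NNReal.coe_zero, sub_zero] at h1 h2
  rw [NNReal.dist_eq, abs_le]
  have h3 : 2 ≤ Real.exp a + Real.exp (-a) := by
    linarith [Real.add_one_le_exp a, Real.add_one_le_exp (-a)]
  constructor <;> nlinarith [t.2, NNReal.coe_nonneg t]

/-- A map of `[0, ∞)` fixing `0` whose slopes are bounded away from `0` and `∞` is a time
change. -/
def orderIsoOfSlopeBound (f : ℝ≥0 → ℝ≥0) (h0 : f 0 = 0) {a : ℝ} (hf : SlopeBound f a) :
    ℝ≥0 ≃o ℝ≥0 :=
  StrictMono.orderIsoOfSurjective f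
    (fun s t hst => by
      have h1 : (0 : ℝ) < t - s := sub_pos.2 (by exact_mod_cast hst)
      have := (hf s t hst.le).1
      have h2 : (0 : ℝ) < (f t : ℝ) - f s := lt_of_lt_of_le (by positivity) this
      exact_mod_cast sub_pos.1 h2)
    (by
      have hc : Continuous f := by
        refine (LipschitzWith.of_dist_le_mul (K := (Real.exp a).toNNReal) fun s t => ?_).continuous
        rw [NNReal.dist_eq, NNReal.dist_eq, Real.coe_toNNReal _ (Real.exp_pos a).le]
        rcases le_total s t with h | h
        · have h1 : (0 : ℝ) ≤ t - s := sub_nonneg.2 (by exact_mod_cast h)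
          have h2 := hf s t h
          have h3 : (0 : ℝ) ≤ (f t : ℝ) - f s := le_trans (by positivity) h2.1
          rw [abs_sub_comm, abs_of_nonneg h3, abs_sub_comm, abs_of_nonneg h1]
          exact h2.2
        · have h1 : (0 : ℝ) ≤ s - t := sub_nonneg.2 (by exact_mod_cast h)
          have h2 := hf t s h
          have h3 : (0 : ℝ) ≤ (f s : ℝ) - f t := le_trans (by positivity) h2.1
          rw [abs_of_nonneg h3, abs_of_nonneg h1]
          exact h2.2
      intro y
      have hy : y ≤ f (y * (Real.exp a).toNNReal) := by
        have := (hf 0 (y * (Real.exp a).toNNReal) zero_le).1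
        simp only [h0, NNReal.coe_zero, sub_zero, NNReal.coe_mul,
          Real.coe_toNNReal _ (Real.exp_pos a).le] at this
        have h : Real.exp (-a) * Real.exp a = 1 := by rw [← Real.exp_add]; simp
        have h' : Real.exp (-a) * (y * Real.exp a) = y := by
          rw [mul_comm (y : ℝ), ← mul_assoc, h, one_mul]
        rw [h'] at this
        exact_mod_cast this
      obtain ⟨x, -, hx⟩ := intermediate_value_Icc (zero_le (a := y * (Real.exp a).toNNReal))
        hc.continuousOn (show y ∈ Icc (f 0) (f (y * (Real.exp a).toNNReal)) from
          ⟨by rw [h0]; exact zero_le, hy⟩)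
      exact ⟨x, hx⟩)

@[simp]
theorem coe_orderIsoOfSlopeBound (f : ℝ≥0 → ℝ≥0) (h0 : f 0 = 0) {a : ℝ} (hf : SlopeBound f a) :
    ⇑(orderIsoOfSlopeBound f h0 hf) = f := rfl

theorem logSlope_trans_le (l m : ℝ≥0 ≃o ℝ≥0) :
    logSlope (l.trans m) ≤ logSlope l + logSlope m := by
  rcases eq_or_ne (logSlope l) ⊤ with h | hl
  · simp [h]
  rcases eq_or_ne (logSlope m) ⊤ with h | hm
  · simp [h]
  have hl' := (logSlope_le_iff ENNReal.toReal_nonneg).1 (ENNReal.ofReal_toReal hl).ge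
  have hm' := (logSlope_le_iff ENNReal.toReal_nonneg).1 (ENNReal.ofReal_toReal hm).ge
  rw [← ENNReal.ofReal_toReal hl, ← ENNReal.ofReal_toReal hm,
    ← ENNReal.ofReal_add ENNReal.toReal_nonneg ENNReal.toReal_nonneg,
    logSlope_le_iff (by positivity)]
  exact hl'.comp l.monotone hm'

theorem logSlope_symm_le (l : ℝ≥0 ≃o ℝ≥0) : logSlope l.symm ≤ logSlope l := by
  rcases eq_or_ne (logSlope l) ⊤ with h | hl
  · simp [h]
  rw [← ENNReal.ofReal_toReal hl, logSlope_le_iff ENNReal.toReal_nonneg]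
  exact ((logSlope_le_iff ENNReal.toReal_nonneg).1 (ENNReal.ofReal_toReal hl).ge).symm

theorem logSlope_refl : logSlope (OrderIso.refl ℝ≥0) = 0 := by
  rw [← nonpos_iff_eq_zero, ← ENNReal.ofReal_zero, logSlope_le_iff le_rfl]
  intro s t _
  simp


/-! ### The Skorokhod metric -/

namespace SkorokhodPath

variable {E : Type*}

@[ext]
theorem ext [TopologicalSpace E] {x₀ : E} {x y : SkorokhodPath x₀} (h : ∀ t, x t = y t) :
    x = y := by
  cases x; cases y; congr; exact funext h

theorem rightContinuous [TopologicalSpace E] {x₀ : E} (x : SkorokhodPath x₀) (t : ℝ≥0) :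
    ContinuousWithinAt x (Ioi t) t := (x.cadlag' t).1

end SkorokhodPath

section

variable {E : Type*} [MetricSpace E] {x₀ : E}

theorem stoppedSupDist_le_one (x y : ℝ≥0 → E) (l : ℝ≥0 ≃o ℝ≥0) (u : ℝ≥0) :
    stoppedSupDist x y l u ≤ 1 :=
  iSup_le fun _ => min_le_left _ _

theorem le_stoppedSupDist (x y : ℝ≥0 → E) (l : ℝ≥0 ≃o ℝ≥0) (u t : ℝ≥0) :
    min 1 (edist (x (min t u)) (y (min (l t) u))) ≤ stoppedSupDist x y l u :=
  le_iSup (fun t => min 1 (edist (x (min t u)) (y (min (l t) u)))) t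

/-- The supremum in `stoppedSupDist` may be taken over a countable dense set of times, by
right-continuity in `t`, and each term is right-continuous in `u`. -/
theorem measurable_stoppedSupDist (x y : SkorokhodPath x₀) (l : ℝ≥0 ≃o ℝ≥0) :
    Measurable (stoppedSupDist x y l) := by
  obtain ⟨D, hDc, hD⟩ := TopologicalSpace.exists_countable_dense ℝ≥0
  have hrc : ∀ g h : ℝ≥0 → ℝ≥0, Monotone g → Continuous g → Monotone h → Continuous h →
      ∀ t, ContinuousWithinAt (fun s => min (1 : ℝ≥0∞) (edist (x (g s)) (y (h s)))) (Ioi t) t := by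
    intro g h hg hgc hh hhc t
    exact continuousWithinAt_const.min ((rightContinuous_comp x.rightContinuous hg hgc t).edist
      (rightContinuous_comp y.rightContinuous hh hhc t))
  have heq : stoppedSupDist x y l =
      fun u => ⨆ t ∈ D, min 1 (edist (x (min t u)) (y (min (l t) u))) := by
    ext u
    refine le_antisymm (iSup_le fun t => ?_) (iSup₂_le fun t _ => le_stoppedSupDist x y l u t)
    obtain ⟨v, -, hv, hvt⟩ := hD.exists_seq_strictAnti_tendsto t
    have hvt' : Tendsto v atTop (𝓝[>] t) :=
      tendsto_nhdsWithin_iff.2 ⟨hvt, Eventually.of_forall fun n => (hv n).1⟩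
    have hc := hrc (fun s => min s u) (fun s => min (l s) u)
      (fun _ _ h => min_le_min_right _ h) (by fun_prop)
      (fun _ _ h => min_le_min_right _ (l.monotone h)) (l.continuous.min continuous_const) t
    exact le_of_tendsto (hc.tendsto.comp hvt') (Eventually.of_forall fun n =>
      le_iSup₂ (f := fun t (_ : t ∈ D) => min 1 (edist (x (min t u)) (y (min (l t) u))))
        (v n) (hv n).2)
  rw [heq]
  refine Measurable.biSup D hDc fun t _ => measurable_of_rightContinuous ?_
  exact hrc (fun u => min t u) (fun u => min (l t) u) (fun _ _ h => min_le_min_left _ h)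
      (by fun_prop) (fun _ _ h => min_le_min_left _ h) (by fun_prop)

/-- The integral in the Skorokhod metric. -/
def skorokhodIntegral (x y : SkorokhodPath x₀) (l : ℝ≥0 ≃o ℝ≥0) : ℝ≥0∞ :=
  ∫⁻ u in Ioi (0 : ℝ), ENNReal.ofReal (Real.exp (-u)) * stoppedSupDist x y l u.toNNReal

theorem lintegral_exp_neg_Ioi (T : ℝ) :
    ∫⁻ u in Ioi T, ENNReal.ofReal (Real.exp (-u)) = ENNReal.ofReal (Real.exp (-T)) := by
  rw [← ofReal_integral_eq_lintegral_ofReal (integrableOn_exp_neg_Ioi T)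
    (Eventually.of_forall fun _ => (Real.exp_pos _).le), integral_exp_neg_Ioi]

theorem skorokhodIntegral_le_one (x y : SkorokhodPath x₀) (l : ℝ≥0 ≃o ℝ≥0) :
    skorokhodIntegral x y l ≤ 1 := by
  calc skorokhodIntegral x y l ≤ ∫⁻ u in Ioi (0 : ℝ), ENNReal.ofReal (Real.exp (-u)) :=
        lintegral_mono fun u => mul_le_of_le_one_right zero_le (stoppedSupDist_le_one _ _ _ _)
    _ = 1 := by rw [lintegral_exp_neg_Ioi]; simp

theorem stoppedSupDist_symm (x y : ℝ≥0 → E) (l : ℝ≥0 ≃o ℝ≥0) (u : ℝ≥0) :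
    stoppedSupDist y x l.symm u = stoppedSupDist x y l u := by
  unfold stoppedSupDist
  rw [← l.toEquiv.iSup_comp]
  simp [edist_comm]

theorem stoppedSupDist_triangle (x y z : ℝ≥0 → E) (l m : ℝ≥0 ≃o ℝ≥0) (u : ℝ≥0) :
    stoppedSupDist x z (l.trans m) u ≤ stoppedSupDist x y l u + stoppedSupDist y z m u := by
  refine iSup_le fun t => ?_
  refine le_trans ?_ (add_le_add (le_stoppedSupDist x y l u t) (le_stoppedSupDist y z m u (l t)))
  set a := edist (x (min t u)) (y (min (l t) u))
  set b := edist (y (min (l t) u)) (z (min (m (l t)) u))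
  have h : edist (x (min t u)) (z (min ((l.trans m) t) u)) ≤ a + b := edist_triangle _ _ _
  rcases le_total 1 a with ha | ha
  · exact (min_le_left _ _).trans (by rw [min_eq_left ha]; exact le_self_add)
  rcases le_total 1 b with hb | hb
  · exact (min_le_left _ _).trans (by rw [min_eq_left hb]; exact le_add_self)
  rw [min_eq_right ha, min_eq_right hb]
  exact (min_le_right _ _).trans h

theorem skorokhodIntegral_symm (x y : SkorokhodPath x₀) (l : ℝ≥0 ≃o ℝ≥0) :
    skorokhodIntegral y x l.symm = skorokhodIntegral x y l := by
  simp only [skorokhodIntegral, stoppedSupDist_symm]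

theorem measurable_skorokhodIntegrand (x y : SkorokhodPath x₀) (l : ℝ≥0 ≃o ℝ≥0) :
    Measurable fun u : ℝ =>
      ENNReal.ofReal (Real.exp (-u)) * stoppedSupDist x y l u.toNNReal := by
  have h := (measurable_stoppedSupDist x y l).comp measurable_real_toNNReal
  exact Measurable.mul (by fun_prop) h

theorem skorokhodIntegral_triangle (x y z : SkorokhodPath x₀) (l m : ℝ≥0 ≃o ℝ≥0) :
    skorokhodIntegral x z (l.trans m) ≤ skorokhodIntegral x y l + skorokhodIntegral y z m := by
  unfold skorokhodIntegral
  rw [← lintegral_add_left (measurable_skorokhodIntegrand x y l)]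
  refine lintegral_mono fun u => ?_
  rw [← mul_add]
  exact mul_le_mul_right (stoppedSupDist_triangle x y z l m _) _

/-- The Skorokhod distance, with values in `[0, ∞]`. -/
def skorokhodEDist (x y : SkorokhodPath x₀) : ℝ≥0∞ :=
  ⨅ l : ℝ≥0 ≃o ℝ≥0, max (logSlope l) (skorokhodIntegral x y l)

theorem skorokhodDist_eq (x y : SkorokhodPath x₀) :
    skorokhodDist x y = (skorokhodEDist x y).toReal := rfl

theorem skorokhodEDist_le (x y : SkorokhodPath x₀) (l : ℝ≥0 ≃o ℝ≥0) :
    skorokhodEDist x y ≤ max (logSlope l) (skorokhodIntegral x y l) := iInf_le _ l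

theorem skorokhodEDist_ne_top (x y : SkorokhodPath x₀) : skorokhodEDist x y ≠ ⊤ := by
  refine ne_top_of_le_ne_top ENNReal.one_ne_top
    ((skorokhodEDist_le x y (OrderIso.refl _)).trans (max_le ?_ (skorokhodIntegral_le_one _ _ _)))
  rw [logSlope_refl]; exact zero_le

theorem skorokhodEDist_self (x : SkorokhodPath x₀) : skorokhodEDist x x = 0 := by
  rw [← nonpos_iff_eq_zero]
  refine (skorokhodEDist_le x x (OrderIso.refl _)).trans (max_le logSlope_refl.le ?_)
  simp [skorokhodIntegral, stoppedSupDist]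

theorem skorokhodEDist_comm (x y : SkorokhodPath x₀) :
    skorokhodEDist x y = skorokhodEDist y x := by
  have h : ∀ x y : SkorokhodPath x₀, skorokhodEDist x y ≤ skorokhodEDist y x := fun x y =>
    le_iInf fun l => (skorokhodEDist_le x y l.symm).trans
      (max_le_max (logSlope_symm_le l) (skorokhodIntegral_symm y x l).le)
  exact le_antisymm (h x y) (h y x)

theorem skorokhodEDist_triangle (x y z : SkorokhodPath x₀) :
    skorokhodEDist x z ≤ skorokhodEDist x y + skorokhodEDist y z := by
  unfold skorokhodEDist
  refine ENNReal.le_iInf_add_iInf fun l m => ?_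
  refine (skorokhodEDist_le x z (l.trans m)).trans (max_le ?_ ?_)
  · exact (logSlope_trans_le l m).trans (add_le_add (le_max_left _ _) (le_max_left _ _))
  · exact (skorokhodIntegral_triangle x y z l m).trans
      (add_le_add (le_max_right _ _) (le_max_right _ _))

/-- If the distance of two paths is small, some time change matches them up to a given time: the
integrand must be small at some `u > T`, as the weight of `(T, ∞)` is `exp (-T)`. -/
theorem exists_timeChange_of_skorokhodEDist_lt {x y : SkorokhodPath x₀} {c T : ℝ} (hc : c ≤ 1)
    (hc0 : 0 < c) (hT : 0 ≤ T)
    (h : skorokhodEDist x y < ENNReal.ofReal (c * Real.exp (-T))) :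
    ∃ l : ℝ≥0 ≃o ℝ≥0, SlopeBound l c ∧
      ∀ t : ℝ≥0, (t : ℝ) ≤ T → (l t : ℝ) ≤ T → dist (x t) (y (l t)) < c := by
  obtain ⟨l, hl⟩ := iInf_lt_iff.1 h
  obtain ⟨hl1, hl2⟩ := max_lt_iff.1 hl
  refine ⟨l, (logSlope_le_iff hc0.le).1 (hl1.le.trans (ENNReal.ofReal_le_ofReal ?_)), ?_⟩
  · exact mul_le_of_le_one_right hc0.le (Real.exp_le_one_iff.2 (by linarith))
  obtain ⟨u, hu, hux⟩ : ∃ u : ℝ, T < u ∧ stoppedSupDist x y l u.toNNReal < ENNReal.ofReal c := by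
    by_contra! hcon
    refine hl2.not_ge ?_
    calc ENNReal.ofReal (c * Real.exp (-T))
        = ∫⁻ u in Ioi T, ENNReal.ofReal (Real.exp (-u)) * ENNReal.ofReal c := by
          rw [lintegral_mul_const _ (by fun_prop), lintegral_exp_neg_Ioi, mul_comm,
            ENNReal.ofReal_mul (Real.exp_pos _).le]
      _ ≤ ∫⁻ u in Ioi T, ENNReal.ofReal (Real.exp (-u)) * stoppedSupDist x y l u.toNNReal :=
          setLIntegral_mono' measurableSet_Ioi fun u hu => mul_le_mul_right (hcon u hu) _
      _ ≤ _ := lintegral_mono_set (Ioi_subset_Ioi hT)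
  intro t ht hlt
  have hle : ∀ s : ℝ≥0, (s : ℝ) ≤ T → min s u.toNNReal = s := fun s hs =>
    min_eq_left (NNReal.le_toNNReal_of_coe_le (hs.trans hu.le))
  have h1 := (le_stoppedSupDist x y l u.toNNReal t).trans_lt hux
  rw [hle t ht, hle _ hlt, min_lt_iff] at h1
  rcases h1 with h1 | h1
  · exact absurd (h1.trans_le (ENNReal.ofReal_le_one.2 hc)) (lt_irrefl _)
  · rwa [edist_dist, ENNReal.ofReal_lt_ofReal_iff hc0] at h1

/-- Nearby paths take nearby values at nearby times. -/
theorem exists_dist_lt_of_skorokhodEDist_lt (s : ℝ≥0) {U : Set ℝ≥0} (hU : U ∈ 𝓝 s) {ε : ℝ}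
    (hε : 0 < ε) : ∃ δ > 0, ∀ x y : SkorokhodPath x₀, skorokhodEDist x y < δ →
      ∃ r ∈ U, dist (x s) (y r) < ε := by
  obtain ⟨c, hc0, hc1, hcε, hcU⟩ : ∃ c : ℝ, 0 < c ∧ c ≤ 1 ∧ c ≤ ε ∧
      ∀ m : ℝ≥0, dist m s ≤ (Real.exp c - 1) * s → m ∈ U ∧ m < s + 1 := by
    have h2 : Tendsto (fun c : ℝ => (Real.exp c - 1) * s) (𝓝 0) (𝓝 0) := by
      have : Continuous (fun c : ℝ => (Real.exp c - 1) * s) := by fun_prop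
      simpa using this.tendsto 0
    obtain ⟨δ, hδ, hball⟩ := Metric.mem_nhds_iff.1 (inter_mem hU (Iio_mem_nhds (lt_add_one s)))
    have h3 := ((h2.eventually_lt_const hδ).filter_mono (nhdsWithin_le_nhds (s := Ioi 0))).and
      (Ioo_mem_nhdsGT (show (0 : ℝ) < min 1 ε by positivity))
    obtain ⟨c, hc, hc0, hc1⟩ := h3.exists
    exact ⟨c, hc0, (hc1.trans_le (min_le_left _ _)).le, (hc1.trans_le (min_le_right _ _)).le,
      fun m hm => hball (hm.trans_lt hc)⟩
  refine ⟨ENNReal.ofReal (c * Real.exp (-(s + 1))), by positivity, fun x y hxy => ?_⟩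
  obtain ⟨l, hl, hlx⟩ := exists_timeChange_of_skorokhodEDist_lt (T := s + 1) hc1 hc0
    (by positivity) hxy
  obtain ⟨h1, h2⟩ := hcU _ (hl.dist_le (map_bot l) s)
  exact ⟨l s, h1, (hlx s (by linarith) (by exact_mod_cast h2.le)).trans_le hcε⟩

/-- Paths at distance `0` agree: by right-continuity it is enough to compare values at times
strictly to the right of `t`. -/
theorem eq_of_skorokhodEDist_eq_zero {x y : SkorokhodPath x₀} (h : skorokhodEDist x y = 0) :
    x = y := by
  ext t
  refine eq_of_forall_dist_le fun ε hε => ?_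
  obtain ⟨v, hv, hxy⟩ : ∃ v > t, ∀ s ∈ Ioo t v, dist (x s) (x t) < ε / 3 ∧
      dist (y s) (y t) < ε / 3 := by
    have h1 := (Metric.tendsto_nhds.1 (x.rightContinuous t).tendsto (ε / 3) (by positivity)).and
      (Metric.tendsto_nhds.1 (y.rightContinuous t).tendsto (ε / 3) (by positivity))
    obtain ⟨v, hv, hsub⟩ := mem_nhdsGT_iff_exists_Ioo_subset.1 h1
    exact ⟨v, hv, fun s hs => hsub hs⟩
  obtain ⟨s, hs⟩ := exists_between hv
  obtain ⟨δ, hδ, hclose⟩ := exists_dist_lt_of_skorokhodEDist_lt (x₀ := x₀) s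
    (isOpen_Ioo.mem_nhds hs) (show 0 < ε / 3 by positivity)
  obtain ⟨r, hr, h1⟩ := hclose x y (h ▸ hδ)
  have h2 := (hxy s hs).1
  have h3 := (hxy r hr).2
  rw [dist_comm] at h2
  linarith [dist_triangle4 (x t) (x s) (y r) (y t)]

instance : MetricSpace (SkorokhodPath x₀) where
  dist := skorokhodDist
  dist_self x := by rw [skorokhodDist_eq, skorokhodEDist_self, ENNReal.toReal_zero]
  dist_comm x y := by rw [skorokhodDist_eq, skorokhodDist_eq, skorokhodEDist_comm]
  dist_triangle x y z := by
    simp only [skorokhodDist_eq]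
    rw [← ENNReal.toReal_add (skorokhodEDist_ne_top _ _) (skorokhodEDist_ne_top _ _)]
    exact ENNReal.toReal_mono (ENNReal.add_ne_top.2
      ⟨skorokhodEDist_ne_top _ _, skorokhodEDist_ne_top _ _⟩) (skorokhodEDist_triangle x y z)
  eq_of_dist_eq_zero {x y} h := eq_of_skorokhodEDist_eq_zero
    (((ENNReal.toReal_eq_zero_iff _).1 h).resolve_right (skorokhodEDist_ne_top _ _))

theorem SkorokhodPath.dist_eq (x y : SkorokhodPath x₀) : dist x y = skorokhodDist x y := rfl

theorem SkorokhodPath.edist_eq (x y : SkorokhodPath x₀) : edist x y = skorokhodEDist x y := by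
  rw [edist_dist, SkorokhodPath.dist_eq, skorokhodDist_eq,
    ENNReal.ofReal_toReal (skorokhodEDist_ne_top x y)]

end


/-! ### Oscillation of càdlàg paths -/

section

variable {E : Type*} [MetricSpace E] {x₀ : E}

/-- A càdlàg path oscillates little between consecutive times of a suitable finite set. -/
theorem exists_finset_dist_lt {x : ℝ≥0 → E} (hx : ∀ t, CadlagAt x t) (T : ℝ≥0) {ε : ℝ}
    (hε : 0 < ε) : ∃ F : Finset ℝ≥0, ∀ s ≤ T, ∀ s', s ≤ s' → (∀ f ∈ F, f ∉ Ioc s s') →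
      dist (x s) (x s') < ε := by
  classical
  suffices h : ∃ F : Finset ℝ≥0, ∀ s ∈ Icc 0 T, ∀ s', s ≤ s' → (∀ f ∈ F, f ∉ Ioc s s') →
      dist (x s) (x s') < ε by
    obtain ⟨F, hF⟩ := h
    exact ⟨F, fun s hs => hF s ⟨zero_le, hs⟩⟩
  refine isCompact_Icc.induction_on (p := fun S => ∃ F : Finset ℝ≥0, ∀ s ∈ S, ∀ s', s ≤ s' →
    (∀ f ∈ F, f ∉ Ioc s s') → dist (x s) (x s') < ε) ⟨∅, by simp⟩ ?_ ?_ ?_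
  · rintro S S' hSS' ⟨F, hF⟩
    exact ⟨F, fun s hs => hF s (hSS' hs)⟩
  · rintro S S' ⟨F, hF⟩ ⟨F', hF'⟩
    refine ⟨F ∪ F', fun s hs s' hss' h => hs.elim (fun hs => hF s hs s' hss' fun f hf => ?_)
      fun hs => hF' s hs s' hss' fun f hf => ?_⟩
    · exact h f (Finset.mem_union_left _ hf)
    · exact h f (Finset.mem_union_right _ hf)
  · intro t _
    obtain ⟨hr, l, hl⟩ := hx t
    have hr' : ∀ᶠ s in 𝓝[≥] t, dist (x s) (x t) < ε / 2 := by
      have : ContinuousWithinAt x (Ici t) t := by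
        rw [← Ioi_insert]; exact continuousWithinAt_insert_self.2 hr
      exact Metric.tendsto_nhds.1 this.tendsto _ (half_pos hε)
    have hl' : ∀ᶠ s in 𝓝[<] t, dist (x s) l < ε / 2 := Metric.tendsto_nhds.1 hl _ (half_pos hε)
    obtain ⟨b, hb, hbs⟩ := mem_nhdsGE_iff_exists_Ico_subset.1 hr'
    have hU : {s | s < t → dist (x s) l < ε / 2} ∩ {s | ∀ r, s ≤ r → r < t → dist (x r) l < ε / 2} ∩
        Iio b ∈ 𝓝 t := by
      refine inter_mem (inter_mem (eventually_nhdsWithin_iff.1 hl') ?_) (Iio_mem_nhds hb)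
      rcases eq_or_ne t 0 with rfl | ht
      · exact Eventually.of_forall fun s r _ h => absurd h (not_lt.2 zero_le)
      · obtain ⟨a, ha, has⟩ := (mem_nhdsLT_iff_exists_Ioo_subset'
          (pos_iff_ne_zero.2 ht)).1 hl'
        filter_upwards [Ioi_mem_nhds ha] with s hs r hsr hrt using has ⟨hs.trans_le hsr, hrt⟩
    -- Near `t`, it is enough to separate the times before `t`, in `[t, b)`, and from `b` on.
    refine ⟨_, mem_nhdsWithin_of_mem_nhds hU, {t, b}, ?_⟩
    rintro s ⟨⟨hs, hs2⟩, hsb⟩ s' hss' hF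
    have hs'b : s' < b := by
      by_contra! hcon
      exact hF b (by simp) ⟨hsb, hcon⟩
    rcases lt_or_ge s t with hst | hst
    · have hs't : s' < t := by
        by_contra! hcon
        exact hF t (by simp) ⟨hst, hcon⟩
      have h2 := hs2 s' hss' hs't
      have h1 := hs hst
      linarith [dist_triangle_right (x s) (x s') l]
    · have h1 : dist (x s) (x t) < ε / 2 := hbs ⟨hst, hsb⟩
      have h2 : dist (x s') (x t) < ε / 2 := hbs ⟨hst.trans hss', hs'b⟩
      linarith [dist_triangle_right (x s) (x s') (x t)]

/-- A path is continuous outside the finite sets of `exists_finset_dist_lt` for `T = n` and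
`ε = 1 / (n + 1)`. -/
theorem countable_not_continuousAt {x : ℝ≥0 → E} (hx : ∀ t, CadlagAt x t) :
    {t | ¬ ContinuousAt x t}.Countable := by
  choose F hF using fun n : ℕ => exists_finset_dist_lt hx n (Nat.one_div_pos_of_nat (n := n))
  refine (countable_iUnion fun n => (F n).countable_toSet).mono fun t ht => ?_
  by_contra hcon
  simp only [mem_iUnion, Finset.mem_coe, not_exists] at hcon
  refine ht (Metric.continuousAt_iff'.2 fun ε hε => ?_)
  obtain ⟨n, hn, htn⟩ : ∃ n : ℕ, 1 / ((n : ℝ) + 1) < ε ∧ t < n := by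
    obtain ⟨n₁, h₁⟩ := exists_nat_one_div_lt hε
    obtain ⟨n₂, h₂⟩ := exists_nat_gt t
    refine ⟨max n₁ n₂, lt_of_le_of_lt ?_ h₁, h₂.trans_le (by exact_mod_cast le_max_right _ _)⟩
    gcongr
    exact le_max_left _ _
  have h1 : ∀ᶠ s in 𝓝 t, ∀ f ∈ F n, f ≤ t → f ≤ s := by
    refine (Filter.eventually_all_finset (F n)).2 fun f hf => ?_
    rcases lt_or_ge t f with h | h
    · exact Eventually.of_forall fun s hs => absurd hs (not_le.2 h)
    · have : f < t := lt_of_le_of_ne h fun hft => hcon n (hft ▸ hf)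
      filter_upwards [Ioi_mem_nhds this] with s hs _ using le_of_lt hs
  have h2 : ∀ᶠ s in 𝓝 t, ∀ f ∈ F n, t < f → s < f := by
    refine (Filter.eventually_all_finset (F n)).2 fun f hf => ?_
    rcases lt_or_ge t f with h | h
    · filter_upwards [Iio_mem_nhds h] with s hs _ using hs
    · exact Eventually.of_forall fun s hs => absurd hs (not_lt.2 h)
  filter_upwards [h1, h2, Iio_mem_nhds htn] with s hs1 hs2 hsn
  rcases le_total s t with hst | hst
  · exact (hF n s (le_of_lt hsn) t hst fun f hf hf' => (hs1 f hf hf'.2).not_gt hf'.1).trans hn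
  · rw [dist_comm]
    exact (hF n t htn.le s hst fun f hf hf' => (hs2 f hf hf'.1).not_ge hf'.2).trans hn

/-! ### A criterion for convergence -/

/-- If time changes with slopes close to `1` match `x` and `y` up to time `u`, then the stopped
supremum is controlled by the oscillation of `y` near `u`. The oscillation enters when `t` or `l t`
exceeds `u`, so that one of the paths is frozen at time `u`. -/
theorem stoppedSupDist_le {x y : ℝ≥0 → E} {l : ℝ≥0 ≃o ℝ≥0} {a ε δ : ℝ} {u : ℝ≥0}
    (hl : SlopeBound l a) (ha : (Real.exp a - 1) * u < δ)
    (hxy : ∀ t ≤ u, dist (x t) (y (l t)) ≤ ε) (hy : ∀ t, dist t u < δ → dist (y t) (y u) ≤ ε) :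
    stoppedSupDist x y l u ≤ ENNReal.ofReal (3 * ε) := by
  have hε : 0 ≤ ε := dist_nonneg.trans (hxy u le_rfl)
  have ha0 : 0 ≤ Real.exp a - 1 ∨ (u : ℝ) = 0 := by
    rcases eq_or_ne u 0 with h | h
    · exact Or.inr (by exact_mod_cast h)
    · have h1 := (dist_nonneg.trans (hl.dist_le (map_bot l) u))
      exact Or.inl (nonneg_of_mul_nonneg_left h1 (by positivity))
  have hclose : ∀ t ≤ u, dist (l t) t < δ := fun t ht => by
    refine (hl.dist_le (map_bot l) t).trans_lt (lt_of_le_of_lt ?_ ha)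
    rcases ha0 with h | h
    · exact mul_le_mul_of_nonneg_left (by exact_mod_cast ht) h
    · have : t = 0 := le_antisymm (ht.trans (by exact_mod_cast h.le)) zero_le
      simp [this, h]
  refine iSup_le fun t => (min_le_right _ _).trans ?_
  rw [edist_dist]
  refine ENNReal.ofReal_le_ofReal ?_
  have hxu : dist (x u) (y u) ≤ 2 * ε := by
    linarith [dist_triangle (x u) (y (l u)) (y u), hxy u le_rfl, hy _ (hclose u le_rfl)]
  have hbetween : ∀ a b c : ℝ≥0, a ≤ b → b ≤ c → ∀ r : ℝ, dist a c < r → dist b c < r ∧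
      dist a b < r := by
    intro a b c hab hbc r h
    rw [NNReal.dist_eq, abs_sub_comm, abs_of_nonneg (sub_nonneg.2 (by exact_mod_cast hab.trans hbc))]
      at h
    rw [NNReal.dist_eq, abs_sub_comm, abs_of_nonneg (sub_nonneg.2 (by exact_mod_cast hbc)),
      NNReal.dist_eq, abs_sub_comm, abs_of_nonneg (sub_nonneg.2 (by exact_mod_cast hab))]
    have h1 : (a : ℝ) ≤ b := by exact_mod_cast hab
    have h2 : (b : ℝ) ≤ c := by exact_mod_cast hbc
    constructor <;> linarith
  rcases le_total t u with htu | htu <;> rcases le_total (l t) u with hlu | hlu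
  · rw [min_eq_left htu, min_eq_left hlu]
    linarith [hxy t htu]
  · rw [min_eq_left htu, min_eq_right hlu]
    have h := hclose t htu
    rw [dist_comm] at h
    have h' := (hbetween t u (l t) htu hlu δ h).1
    rw [dist_comm] at h'
    linarith [dist_triangle (x t) (y (l t)) (y u), hxy t htu, hy _ h']
  · rw [min_eq_right htu, min_eq_left hlu]
    have h' := (hbetween (l u) (l t) u (l.monotone htu) hlu δ (hclose u le_rfl)).1
    linarith [dist_triangle_right (x u) (y (l t)) (y u), hxu, hy _ h']
  · rw [min_eq_right htu, min_eq_right hlu]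
    linarith

/-- Paths converge in the Skorokhod metric if time changes with slopes tending to `1` match them with
the limit, uniformly on bounded intervals. -/
theorem tendsto_of_timeChange {x : ℕ → SkorokhodPath x₀} {y : SkorokhodPath x₀}
    {l : ℕ → ℝ≥0 ≃o ℝ≥0} {a : ℕ → ℝ} (ha0 : ∀ n, 0 ≤ a n) (ha : Tendsto a atTop (𝓝 0))
    (hl : ∀ n, SlopeBound (l n) (a n))
    (hxy : ∀ T : ℝ≥0, ∀ ε > 0, ∀ᶠ n in atTop, ∀ t ≤ T, dist (x n t) (y (l n t)) ≤ ε) :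
    Tendsto x atTop (𝓝 y) := by
  rw [tendsto_iff_edist_tendsto_0]
  have hint : Tendsto (fun n => skorokhodIntegral (x n) y (l n)) atTop (𝓝 0) := by
    have hcount : ((fun t : ℝ≥0 => (t : ℝ)) '' {t | ¬ ContinuousAt y t}).Countable :=
      (countable_not_continuousAt y.cadlag').image _
    have := tendsto_lintegral_of_dominated_convergence (μ := volume.restrict (Ioi (0 : ℝ)))
      (F := fun n u => ENNReal.ofReal (Real.exp (-u)) * stoppedSupDist (x n) y (l n) u.toNNReal)
      (f := fun _ => 0) (fun u => ENNReal.ofReal (Real.exp (-u)))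
      (fun n => measurable_skorokhodIntegrand _ _ _)
      (fun n => Eventually.of_forall fun u =>
        mul_le_of_le_one_right zero_le (stoppedSupDist_le_one _ _ _ _))
      (by rw [lintegral_exp_neg_Ioi]; exact ENNReal.ofReal_ne_top) ?_
    · simpa [skorokhodIntegral] using this
    filter_upwards [ae_restrict_of_ae (hcount.ae_notMem volume),
      ae_restrict_mem measurableSet_Ioi] with u hu hu0
    lift u to ℝ≥0 using le_of_lt hu0
    have huc : ContinuousAt y u := by
      by_contra hcon
      exact hu ⟨u, hcon, rfl⟩
    rw [Real.toNNReal_coe]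
    rw [← mul_zero (ENNReal.ofReal (Real.exp (-u)))]
    refine ENNReal.Tendsto.const_mul ?_ (Or.inr ENNReal.ofReal_ne_top)
    refine ENNReal.tendsto_nhds_zero.2 fun η hη => ?_
    rcases eq_or_ne η ⊤ with rfl | hη'
    · simp
    obtain ⟨ε, hε, rfl⟩ : ∃ ε : ℝ, 0 < ε ∧ ENNReal.ofReal (3 * ε) = η :=
      ⟨η.toReal / 3, div_pos (ENNReal.toReal_pos hη.ne' hη') (by norm_num), by
        rw [mul_div_cancel₀ _ (by norm_num), ENNReal.ofReal_toReal hη']⟩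
    obtain ⟨δ, hδ, hδy⟩ := Metric.continuousAt_iff.1 huc ε hε
    have h1 : Tendsto (fun n => (Real.exp (a n) - 1) * u) atTop (𝓝 0) := by
      have : Continuous fun c : ℝ => (Real.exp c - 1) * u := by fun_prop
      simpa [Function.comp_def] using (this.tendsto 0).comp ha
    filter_upwards [h1.eventually_lt_const hδ, hxy u ε hε] with n hn1 hn2
    exact stoppedSupDist_le (hl n) hn1 hn2 fun t ht => (hδy ht).le
  have hmax : Tendsto (fun n => max (ENNReal.ofReal (a n)) (skorokhodIntegral (x n) y (l n)))
      atTop (𝓝 0) := by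
    simpa using (ENNReal.tendsto_ofReal ha).max hint
  refine tendsto_of_tendsto_of_tendsto_of_le_of_le tendsto_const_nhds hmax
    (fun _ => zero_le) fun n => ?_
  rw [SkorokhodPath.edist_eq]
  exact (skorokhodEDist_le _ _ (l n)).trans
    (max_le_max ((logSlope_le_iff (ha0 n)).2 (hl n)) le_rfl)

end


/-! ### Completeness of the Skorokhod space -/

/-- The composition `l (n - 1) ∘ ⋯ ∘ l 0` of time changes. -/
def iterTimeChange (l : ℕ → ℝ≥0 ≃o ℝ≥0) : ℕ → ℝ≥0 ≃o ℝ≥0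
  | 0 => OrderIso.refl _
  | n + 1 => (iterTimeChange l n).trans (l n)

section

variable {l : ℕ → ℝ≥0 ≃o ℝ≥0} (hl : ∀ n, SlopeBound (l n) ((1 / 2) ^ n))
include hl

/-- Increments of the composed time changes, times `exp (2 * 2⁻ⁿ)`, decrease with `n`; here
`2 * 2⁻ⁿ = ∑_{k ≥ n} 2⁻ᵏ` bounds the slopes of all later factors. -/
theorem antitone_iterTimeChange {s t : ℝ≥0} (hst : s ≤ t) :
    Antitone fun n => Real.exp (2 * (1 / 2) ^ n) *
      ((iterTimeChange l n t : ℝ) - iterTimeChange l n s) := by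
  refine antitone_nat_of_succ_le fun n => ?_
  have h := (hl n _ _ ((iterTimeChange l n).monotone hst)).2
  calc _ ≤ Real.exp (2 * (1 / 2) ^ (n + 1)) * (Real.exp ((1 / 2) ^ n) *
        ((iterTimeChange l n t : ℝ) - iterTimeChange l n s)) :=
        mul_le_mul_of_nonneg_left h (Real.exp_pos _).le
    _ = _ := by rw [← mul_assoc, ← Real.exp_add]; congr 2; ring

theorem monotone_iterTimeChange {s t : ℝ≥0} (hst : s ≤ t) :
    Monotone fun n => Real.exp (-(2 * (1 / 2) ^ n)) *
      ((iterTimeChange l n t : ℝ) - iterTimeChange l n s) := by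
  refine monotone_nat_of_le_succ fun n => ?_
  have h := (hl n _ _ ((iterTimeChange l n).monotone hst)).1
  calc _ = Real.exp (-(2 * (1 / 2) ^ (n + 1))) * (Real.exp (-(1 / 2) ^ n) *
        ((iterTimeChange l n t : ℝ) - iterTimeChange l n s)) := by
        rw [← mul_assoc, ← Real.exp_add]; congr 2; ring
    _ ≤ _ := mul_le_mul_of_nonneg_left h (Real.exp_pos _).le

theorem slopeBound_iterTimeChange (n : ℕ) : SlopeBound (iterTimeChange l n) 2 := by
  intro s t hst
  have h1 := antitone_iterTimeChange hl hst (Nat.zero_le n)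
  have h2 := monotone_iterTimeChange hl hst (Nat.zero_le n)
  simp only [iterTimeChange, pow_zero, mul_one, OrderIso.refl_apply] at h1 h2
  have h3 : (0 : ℝ) ≤ (iterTimeChange l n t : ℝ) - iterTimeChange l n s :=
    sub_nonneg.2 (by exact_mod_cast (iterTimeChange l n).monotone hst)
  have h4 : (0 : ℝ) ≤ 2 * (1 / 2) ^ n := by positivity
  exact ⟨h2.trans (mul_le_of_le_one_left h3 (Real.exp_le_one_iff.2 (by linarith))),
    (le_mul_of_one_le_left h3 (Real.one_le_exp h4)).trans h1⟩

/-- The composed time changes converge to a time change, and the slopes of the remaining factor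
tend to `1`. -/
theorem exists_limit_iterTimeChange : ∃ L : ℝ≥0 ≃o ℝ≥0, ∀ n,
    SlopeBound ((iterTimeChange l n).symm.trans L) (2 * (1 / 2) ^ n) := by
  have hpow : Tendsto (fun n : ℕ => 2 * (1 / 2 : ℝ) ^ n) atTop (𝓝 0) := by
    simpa using (tendsto_pow_atTop_nhds_zero_of_lt_one (r := (1 / 2 : ℝ)) (by norm_num)
      (by norm_num)).const_mul 2
  have hexp : Tendsto (fun n : ℕ => Real.exp (2 * (1 / 2 : ℝ) ^ n)) atTop (𝓝 1) := by
    simpa [Function.comp_def] using (Real.continuous_exp.tendsto 0).comp hpow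
  have hexp' : Tendsto (fun n : ℕ => Real.exp (-(2 * (1 / 2 : ℝ) ^ n))) atTop (𝓝 1) := by
    simpa [Function.comp_def] using (Real.continuous_exp.tendsto (-0)).comp hpow.neg
  have hlim : ∀ t : ℝ≥0, ∃ v : ℝ≥0, Tendsto (fun n => (iterTimeChange l n t : ℝ)) atTop (𝓝 v) := by
    intro t
    have hanti := antitone_iterTimeChange hl (zero_le (a := t))
    have h0 : ∀ n, iterTimeChange l n 0 = 0 := fun n => map_bot _
    simp only [h0, NNReal.coe_zero, sub_zero] at hanti
    have h := tendsto_atTop_ciInf hanti ⟨0, by rintro _ ⟨n, rfl⟩; positivity⟩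
    have h' := hexp'.mul h
    simp only [← mul_assoc, ← Real.exp_add, neg_add_cancel, Real.exp_zero, one_mul] at h'
    exact ⟨⟨_, ge_of_tendsto' h' fun n => NNReal.coe_nonneg _⟩, h'⟩
  choose L hL using hlim
  have hbound : ∀ n, ∀ s t : ℝ≥0, s ≤ t → Real.exp (-(2 * (1 / 2) ^ n)) *
      ((iterTimeChange l n t : ℝ) - iterTimeChange l n s) ≤ (L t : ℝ) - L s ∧
      (L t : ℝ) - L s ≤ Real.exp (2 * (1 / 2) ^ n) *
      ((iterTimeChange l n t : ℝ) - iterTimeChange l n s) := by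
    intro n s t hst
    have h := (hL t).sub (hL s)
    have h1 := hexp.mul h
    have h2 := hexp'.mul h
    rw [one_mul] at h1 h2
    exact ⟨ge_of_tendsto h2 (eventually_atTop.2 ⟨n, fun m hm =>
        monotone_iterTimeChange hl hst hm⟩),
      le_of_tendsto h1 (eventually_atTop.2 ⟨n, fun m hm =>
        antitone_iterTimeChange hl hst hm⟩)⟩
  have hL0 : L 0 = 0 := by
    refine NNReal.coe_injective (tendsto_nhds_unique (hL 0) ?_)
    have h0 : ∀ n, iterTimeChange l n 0 = 0 := fun n => map_bot _
    simp [h0]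
  have hLs : SlopeBound L 2 := by
    intro s t hst
    simpa [iterTimeChange] using hbound 0 s t hst
  refine ⟨orderIsoOfSlopeBound L hL0 hLs, fun n s t hst => ?_⟩
  simpa using hbound n _ _ ((iterTimeChange l n).symm.monotone hst)

end

section

variable {E : Type*} [MetricSpace E] {x₀ : E}

theorem cadlagAt_of_uniform_limit [CompleteSpace E] {z : ℝ≥0 → E} {t T : ℝ≥0} (htT : t < T)
    (h : ∀ ε > 0, ∃ y : ℝ≥0 → E, CadlagAt y t ∧ ∀ s ≤ T, dist (z s) (y s) ≤ ε) :
    CadlagAt z t := by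
  constructor
  · refine Metric.tendsto_nhds.2 fun ε hε => ?_
    obtain ⟨y, hy, hyz⟩ := h (ε / 3) (by positivity)
    filter_upwards [Metric.tendsto_nhds.1 hy.1.tendsto (ε / 3) (by positivity),
      nhdsWithin_le_nhds (Iio_mem_nhds htT)] with s hs hsT
    have h1 := hyz s (le_of_lt hsT)
    have h2 := hyz t htT.le
    rw [dist_comm] at h2
    linarith [dist_triangle4 (z s) (y s) (y t) (z t)]
  · rcases eq_or_neBot (𝓝[<] t) with hbot | hne
    · exact ⟨z t, by rw [hbot]; exact tendsto_bot⟩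
    have hcau : Cauchy (map z (𝓝[<] t)) := by
      refine Metric.cauchy_iff.2 ⟨inferInstance, fun ε hε => ?_⟩
      obtain ⟨y, ⟨-, l, hl⟩, hyz⟩ := h (ε / 5) (by positivity)
      refine ⟨z '' {s | dist (y s) l < ε / 5 ∧ s < t}, image_mem_map
        ((Metric.tendsto_nhds.1 hl (ε / 5) (by positivity)).and self_mem_nhdsWithin), ?_⟩
      rintro _ ⟨s, ⟨hs, hst⟩, rfl⟩ _ ⟨r, ⟨hr, hrt⟩, rfl⟩
      have h1 := hyz s (hst.trans htT).le
      have h2 := hyz r (hrt.trans htT).le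
      rw [dist_comm] at h2
      linarith [dist_triangle4 (z s) (y s) (y r) (z r), dist_triangle_right (y s) (y r) l]
    exact cauchy_map_iff_exists_tendsto.1 hcau

/-- For paths with `d(x n, x (n + 1)) < 2⁻ⁿ exp (-n)`, time changes with slopes bounded by
`exp (± 2⁻ⁿ)` match consecutive paths up to `2⁻ⁿ` on `[0, n]`. If `M n` is the composition of the
first `n` time changes and `L` is the limit of `M`, then `x n ∘ M n` converges to some `z`, uniformly
on bounded intervals, and `x n` converges to `z ∘ L⁻¹`. -/
instance [CompleteSpace E] : CompleteSpace (SkorokhodPath x₀) := by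
  refine EMetric.complete_of_convergent_controlled_sequences
    (fun n => ENNReal.ofReal ((1 / 2) ^ n * Real.exp (-n))) (fun n => by positivity) fun x hx => ?_
  have hex : ∀ n : ℕ, ∃ l : ℝ≥0 ≃o ℝ≥0, SlopeBound l ((1 / 2) ^ n) ∧ ∀ t : ℝ≥0, (t : ℝ) ≤ n →
      (l t : ℝ) ≤ n → dist (x n t) (x (n + 1) (l t)) < (1 / 2) ^ n := fun n => by
    have h := hx n n (n + 1) le_rfl n.le_succ
    rw [SkorokhodPath.edist_eq] at h
    exact exists_timeChange_of_skorokhodEDist_lt (pow_le_one₀ (by norm_num) (by norm_num))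
      (by positivity) n.cast_nonneg h
  choose l hl hlx using hex
  obtain ⟨L, hL⟩ := exists_limit_iterTimeChange hl
  set M := iterTimeChange l with hM
  have hM2 : ∀ n, SlopeBound (M n) 2 := slopeBound_iterTimeChange hl
  have hM0 : ∀ n, M n 0 = 0 := fun n => map_bot _
  -- After the time changes `M n`, the paths are uniformly Cauchy on bounded intervals.
  have hstep : ∀ (T : ℝ≥0) (n : ℕ), Real.exp 2 * T ≤ n → ∀ t ≤ T,
      dist (x n (M n t)) (x (n + 1) (M (n + 1) t)) ≤ (1 / 2) ^ n := by
    intro T n hn t ht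
    have hle : ∀ k, (M k t : ℝ) ≤ n := fun k => ((hM2 k).le_exp_mul (hM0 k) t).trans
      ((mul_le_mul_of_nonneg_left (by exact_mod_cast ht) (Real.exp_pos _).le).trans hn)
    exact (hlx n (M n t) (hle n) (hle (n + 1))).le
  have hgeom : ∀ (T : ℝ≥0) (n : ℕ), Real.exp 2 * T ≤ n → ∀ t ≤ T, ∀ k,
      dist (x (n + k) (M (n + k) t)) (x (n + k + 1) (M (n + k + 1) t)) ≤
        2 * (1 / 2) ^ n / 2 / 2 ^ k := by
    intro T n hn t ht k
    refine (hstep T (n + k) (hn.trans (by push_cast; linarith [k.cast_nonneg (α := ℝ)])) t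
      ht).trans (le_of_eq ?_)
    rw [pow_add]
    field_simp
    rw [← mul_pow]
    norm_num
  have hconv : ∀ t : ℝ≥0, ∃ z : E, Tendsto (fun n => x n (M n t)) atTop (𝓝 z) := by
    intro t
    obtain ⟨n, hn⟩ := exists_nat_ge (Real.exp 2 * t)
    obtain ⟨z, hz⟩ := cauchySeq_tendsto_of_complete
      (cauchySeq_of_le_geometric_two (hgeom t n hn t le_rfl))
    refine ⟨z, (tendsto_add_atTop_iff_nat n).1 (hz.congr fun k => ?_)⟩
    rw [add_comm]
  choose z hz using hconv
  have hunif : ∀ (T : ℝ≥0) (n : ℕ), Real.exp 2 * T ≤ n → ∀ t ≤ T,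
      dist (x n (M n t)) (z t) ≤ 2 * (1 / 2) ^ n := by
    intro T n hn t ht
    have h := dist_le_of_le_geometric_two_of_tendsto₀ (hgeom T n hn t ht)
      (a := z t) (((tendsto_add_atTop_iff_nat n).2 (hz t)).congr fun k => by rw [add_comm])
    simpa using h
  have hpow : Tendsto (fun n : ℕ => 2 * (1 / 2 : ℝ) ^ n) atTop (𝓝 0) := by
    simpa using (tendsto_pow_atTop_nhds_zero_of_lt_one (r := (1 / 2 : ℝ)) (by norm_num)
      (by norm_num)).const_mul 2
  have hunif' : ∀ (T : ℝ≥0), ∀ ε > 0, ∀ᶠ n in atTop, ∀ t ≤ T, dist (x n (M n t)) (z t) ≤ ε := by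
    intro T ε hε
    obtain ⟨N, hN⟩ := exists_nat_ge (Real.exp 2 * T)
    filter_upwards [hpow.eventually_lt_const hε, eventually_ge_atTop N] with n hn hNn t ht
    exact (hunif T n (hN.trans (by exact_mod_cast hNn)) t ht).trans hn.le
  have hzc : ∀ t, CadlagAt z t := fun t =>
    cadlagAt_of_uniform_limit (lt_add_one t) fun ε hε => by
      obtain ⟨n, hn⟩ := (hunif' (t + 1) ε hε).exists
      exact ⟨fun s => x n (M n s), ((x n).cadlag' _).comp_strictMono (M n).strictMono
        (M n).continuous, fun s hs => by rw [dist_comm]; exact hn s hs⟩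
  have hz0 : z 0 = x₀ := tendsto_nhds_unique (hz 0) (by simp [hM0, (x _).map_zero'])
  refine ⟨⟨fun t => z (L.symm t), ?_, fun t => (hzc _).comp_strictMono L.symm.strictMono
    L.symm.continuous⟩, tendsto_of_timeChange (l := fun n => (M n).symm.trans L)
    (fun n => by positivity) hpow hL fun T ε hε => ?_⟩
  · rw [show L.symm 0 = 0 from map_bot _, hz0]
  · filter_upwards [hunif' (T * (Real.exp 2).toNNReal) ε hε] with n hn t ht
    have hs : (M n).symm t ≤ T * (Real.exp 2).toNNReal := by
      have h1 := (hM2 n).symm.le_exp_mul (map_bot _) t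
      rw [← NNReal.coe_le_coe, NNReal.coe_mul, Real.coe_toNNReal _ (Real.exp_pos _).le]
      refine h1.trans ?_
      rw [mul_comm]
      exact mul_le_mul_of_nonneg_right (by exact_mod_cast ht) (Real.exp_pos _).le
    simpa using hn _ hs

end


/-! ### Separability of the Skorokhod space -/

/-- The number of elements of `F` up to time `t`. -/
def countUpTo (F : Finset ℝ≥0) (t : ℝ≥0) : ℕ := (F.filter (· ≤ t)).card

theorem eventually_countUpTo_eq (F : Finset ℝ≥0) (t : ℝ≥0) :
    ∀ᶠ s in 𝓝[>] t, countUpTo F s = countUpTo F t := by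
  have : ∀ᶠ s in 𝓝[>] t, ∀ f ∈ F, (f ≤ s ↔ f ≤ t) := by
    refine (Filter.eventually_all_finset F).2 fun f _ => ?_
    rcases le_or_gt f t with h | h
    · filter_upwards [self_mem_nhdsWithin] with s hs
      exact iff_of_true (h.trans (le_of_lt hs)) h
    · filter_upwards [nhdsWithin_le_nhds (Iio_mem_nhds h)] with s hs
      exact iff_of_false (not_le.2 hs) (not_le.2 h)
  filter_upwards [this] with s hs
  rw [countUpTo, countUpTo, Finset.filter_congr hs]

theorem eventually_countUpTo_eq_left (F : Finset ℝ≥0) (t : ℝ≥0) :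
    ∀ᶠ s in 𝓝[<] t, countUpTo F s = (F.filter (· < t)).card := by
  have : ∀ᶠ s in 𝓝[<] t, ∀ f ∈ F, (f ≤ s ↔ f < t) := by
    refine (Filter.eventually_all_finset F).2 fun f _ => ?_
    rcases lt_or_ge f t with h | h
    · filter_upwards [nhdsWithin_le_nhds (Ioi_mem_nhds h)] with s hs
      exact iff_of_true (le_of_lt hs) h
    · filter_upwards [self_mem_nhdsWithin] with s hs
      exact iff_of_false (not_le.2 (lt_of_lt_of_le hs h)) (not_lt.2 h)
  filter_upwards [this] with s hs
  rw [countUpTo, Finset.filter_congr hs]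

theorem notMem_Ioc_of_countUpTo_eq {F : Finset ℝ≥0} {s s' : ℝ≥0} (hs : s ≤ s')
    (h : countUpTo F s = countUpTo F s') : ∀ f ∈ F, f ∉ Ioc s s' := by
  rintro f hf ⟨h1, h2⟩
  refine (Finset.card_lt_card ?_).ne h
  refine Finset.ssubset_iff_of_subset (Finset.monotone_filter_right F
    (fun a _ ha => ha.trans hs)) |>.2 ⟨f, ?_⟩
  simp [hf, h2, h1]

theorem countUpTo_image (F : Finset ℝ≥0) (l : ℝ≥0 ≃o ℝ≥0) (t : ℝ≥0) :
    countUpTo (F.image l) (l t) = countUpTo F t := by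
  rw [countUpTo, countUpTo, Finset.filter_image, Finset.card_image_of_injective _ l.injective]
  simp

theorem countUpTo_zero {F : Finset ℝ≥0} (h : 0 ∉ F) : countUpTo F 0 = 0 := by
  rw [countUpTo, Finset.card_eq_zero, Finset.filter_eq_empty_iff]
  intro f hf hf0
  exact h (le_antisymm hf0 zero_le ▸ hf)

/-- The step function which jumps at the positive elements of `F`, and takes the value `v k` after
the `k`-th jump. -/
def stepPath {E : Type*} [TopologicalSpace E] (x₀ : E) (F : Finset ℝ≥0) (v : ℕ → E) :
    SkorokhodPath x₀ where
  toFun t := if countUpTo (F.erase 0) t = 0 then x₀ else v (countUpTo (F.erase 0) t)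
  map_zero' := by simp [countUpTo_zero]
  cadlag' t := by
    refine ⟨tendsto_nhds_of_eventually_eq ?_,
      if ((F.erase 0).filter (· < t)).card = 0 then x₀ else v ((F.erase 0).filter (· < t)).card,
      tendsto_nhds_of_eventually_eq ?_⟩
    · filter_upwards [eventually_countUpTo_eq (F.erase 0) t] with s hs
      rw [hs]
    · filter_upwards [eventually_countUpTo_eq_left (F.erase 0) t] with s hs
      rw [hs]

/-- Finitely many positive times can be moved into a dense set by a time change with slopes close
to `1`. The times are moved one by one: if `S` consists of `0` and the times already dealt with, then
`t ↦ t + κ * dist(t, S)` fixes `S` and, for a suitable small `κ`, moves the next time into the dense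
set. -/
theorem exists_timeChange_mem_dense {D : Set ℝ≥0} (hD : Dense D) (F : Finset ℝ≥0) (h0 : 0 ∉ F) :
    ∀ c : ℝ, 0 < c → ∃ l : ℝ≥0 ≃o ℝ≥0, SlopeBound l c ∧ ∀ f ∈ F, l f ∈ D := by
  classical
  induction F using Finset.induction_on with
  | empty =>
    intro c hc
    exact ⟨OrderIso.refl _, (((logSlope_le_iff le_rfl).1 (by simp [logSlope_refl])).mono hc.le),
      by simp⟩
  | insert p F hp ih =>
    intro c hc
    simp only [Finset.mem_insert, not_or] at h0
    obtain ⟨l, hl, hlF⟩ := ih h0.2 (c / 2) (half_pos hc)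
    set S : Set ℝ≥0 := insert 0 (l '' F) with hS
    have hSf : IsClosed S := (Set.Finite.insert 0 (F.finite_toSet.image l)).isClosed
    have hSne : S.Nonempty := ⟨0, mem_insert _ _⟩
    have hpS : l p ∉ S := by
      rw [hS, mem_insert_iff, not_or]
      constructor
      · intro h
        exact h0.1 (l.injective (h.trans (map_bot l).symm)).symm
      · rintro ⟨f, hf, hfp⟩
        exact hp (l.injective hfp ▸ hf)
    have hg : 0 < Metric.infNndist (l p) S := by
      rw [← NNReal.coe_pos, Metric.coe_infNndist]
      exact (hSf.notMem_iff_infDist_pos hSne).1 hpS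
    have hδ : 0 < 1 - Real.exp (-(c / 2)) := sub_pos.2 (Real.exp_lt_one_iff.2 (by linarith))
    obtain ⟨d, hd, hpd, hd'⟩ := hD.exists_between (show l p < l p +
      (1 - Real.exp (-(c / 2))).toNNReal * Metric.infNndist (l p) S from
        lt_add_of_pos_right _ (mul_pos (Real.toNNReal_pos.2 hδ) hg))
    -- The bound on `κ` gives slopes `≥ 1 - κ ≥ exp (-c / 2)` and `≤ 1 + κ ≤ exp (c / 2)`.
    set κ : ℝ≥0 := (d - l p) / Metric.infNndist (l p) S with hκ
    have hκd : l p + κ * Metric.infNndist (l p) S = d := by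
      rw [hκ, div_mul_cancel₀ _ hg.ne', add_tsub_cancel_of_le hpd.le]
    have hκ1 : (κ : ℝ) ≤ 1 - Real.exp (-(c / 2)) := by
      have h1 : κ ≤ (1 - Real.exp (-(c / 2))).toNNReal := by
        rw [hκ, div_le_iff₀ hg]
        exact tsub_le_iff_left.2 hd'.le
      have := NNReal.coe_le_coe.2 h1
      rwa [Real.coe_toNNReal _ hδ.le] at this
    have hm : SlopeBound (fun t => t + κ * Metric.infNndist t S) (c / 2) := by
      intro s t hst
      have hst' : (0 : ℝ) ≤ t - s := sub_nonneg.2 (by exact_mod_cast hst)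
      have h1 : |(Metric.infNndist t S : ℝ) - Metric.infNndist s S| ≤ (t : ℝ) - s := by
        have := (Metric.lipschitz_infNndist_pt S).dist_le_mul t s
        rwa [NNReal.dist_eq, NNReal.dist_eq, NNReal.coe_one, one_mul, abs_of_nonneg hst'] at this
      have h2 := abs_le.1 h1
      have h3 : 1 + (κ : ℝ) ≤ Real.exp (c / 2) := by
        have h4 := Real.add_one_le_exp (-(c / 2))
        have h5 := Real.add_one_le_exp (c / 2)
        linarith
      have h6 : (0 : ℝ) ≤ κ := κ.2
      have e : ((t + κ * Metric.infNndist t S : ℝ≥0) : ℝ) - (s + κ * Metric.infNndist s S : ℝ≥0)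
          = (t - s) + κ * ((Metric.infNndist t S : ℝ) - Metric.infNndist s S) := by
        push_cast; ring
      rw [e]
      constructor
      · nlinarith
      · nlinarith
    have hm0 : (fun t => t + κ * Metric.infNndist t S) 0 = 0 := by
      have : Metric.infNndist 0 S = 0 := by
        rw [← NNReal.coe_eq_zero, Metric.coe_infNndist]
        exact Metric.infDist_zero_of_mem (mem_insert _ _)
      simp [this]
    refine ⟨l.trans (orderIsoOfSlopeBound _ hm0 hm), ?_, ?_⟩
    · have := hl.comp l.monotone hm
      rwa [add_halves] at this
    · intro f hf
      rcases Finset.mem_insert.1 hf with rfl | hf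
      · simpa [hκd] using hd
      · have : Metric.infNndist (l f) S = 0 := by
          rw [← NNReal.coe_eq_zero, Metric.coe_infNndist]
          exact Metric.infDist_zero_of_mem (mem_insert_of_mem _ ⟨f, hf, rfl⟩)
        simpa [this] using hlF f hf

section

variable {E : Type*} [MetricSpace E] {x₀ : E}

/-- Up to a small time change and a small error, a càdlàg path is a step function with jumps in a
given dense set and values in a given dense sequence. -/
theorem exists_stepPath_dist_lt {D : Set ℝ≥0} (hD : Dense D) {e : ℕ → E} (he : DenseRange e)
    (x : SkorokhodPath x₀) (T : ℝ≥0) {ε : ℝ} (hε : 0 < ε) :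
    ∃ (F : Finset D) (v : List ℕ) (l : ℝ≥0 ≃o ℝ≥0), SlopeBound l ε ∧ ∀ s ≤ T,
      dist (stepPath x₀ (F.map (Function.Embedding.subtype _)) (fun k => e (v.getD k 0)) (l s))
        (x s) ≤ ε := by
  classical
  obtain ⟨F₀, hF₀⟩ := exists_finset_dist_lt x.cadlag' T (half_pos hε)
  set F := F₀.erase 0 with hFdef
  have hF0 : 0 ∉ F := Finset.notMem_erase 0 F₀
  have hosc : ∀ s ≤ T, ∀ s' ≤ T, countUpTo F s = countUpTo F s' →
      dist (x s) (x s') < ε / 2 := by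
    have key : ∀ s ≤ T, ∀ s' ≤ T, s ≤ s' → countUpTo F s = countUpTo F s' →
        dist (x s) (x s') < ε / 2 := by
      intro s hs s' _ hss' h
      refine hF₀ s hs s' hss' fun f hf hf' => ?_
      exact notMem_Ioc_of_countUpTo_eq hss' h f
        (Finset.mem_erase.2 ⟨(zero_le.trans_lt hf'.1).ne', hf⟩) hf'
    intro s hs s' hs' h
    rcases le_total s s' with hss' | hss'
    · exact key s hs s' hs' hss' h
    · rw [dist_comm]
      exact key s' hs' s hs hss' h.symm
  obtain ⟨l, hl, hlD⟩ := exists_timeChange_mem_dense hD F hF0 ε hε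
  -- The value after the `k`-th jump approximates any value of `x` between consecutive times of `F`.
  have hv : ∀ k : ℕ, ∃ i : ℕ, ∀ s ≤ T, countUpTo F s = k → dist (e i) (x s) ≤ ε := by
    intro k
    by_cases h : ∃ s ≤ T, countUpTo F s = k
    · obtain ⟨s, hs, rfl⟩ := h
      obtain ⟨i, hi⟩ := he.exists_dist_lt (x s) (half_pos hε)
      refine ⟨i, fun s' hs' h => ?_⟩
      rw [dist_comm] at hi
      linarith [dist_triangle (e i) (x s) (x s'), hosc s hs s' hs' h.symm]
    · exact ⟨0, fun s hs hk => absurd ⟨s, hs, hk⟩ h⟩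
  choose i hi using hv
  refine ⟨(F.image l).subtype (· ∈ D), (List.range (F.card + 1)).map i, l, hl, fun s hs => ?_⟩
  have hFD : ((F.image l).subtype (· ∈ D)).map (Function.Embedding.subtype _) = F.image l := by
    refine Finset.subtype_map_of_mem fun f hf => ?_
    obtain ⟨g, hg, rfl⟩ := Finset.mem_image.1 hf
    exact hlD g hg
  have h0 : 0 ∉ F.image l := by
    intro h
    obtain ⟨g, hg, hg0⟩ := Finset.mem_image.1 h
    have : g = 0 := l.injective (hg0.trans (map_bot l).symm)
    exact hF0 (this ▸ hg)
  have hlt : countUpTo F s < F.card + 1 := Nat.lt_succ_of_le (Finset.card_filter_le _ _)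
  simp only [stepPath, hFD, Finset.erase_eq_of_notMem h0, countUpTo_image]
  split_ifs with h
  · have := hosc 0 zero_le s hs (by rw [h, countUpTo_zero hF0])
    rw [x.map_zero'] at this
    linarith
  · rw [List.getD_eq_getElem _ _ (by simpa using hlt)]
    simpa using hi _ s hs rfl

instance [TopologicalSpace.SeparableSpace E] :
    TopologicalSpace.SeparableSpace (SkorokhodPath x₀) := by
  obtain ⟨D, hDc, hD⟩ := TopologicalSpace.exists_countable_dense ℝ≥0
  have : Nonempty E := ⟨x₀⟩
  obtain ⟨e, he⟩ := TopologicalSpace.exists_dense_seq E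
  have : Countable D := hDc.to_subtype
  let y : Finset D × List ℕ → SkorokhodPath x₀ := fun p =>
    stepPath x₀ (p.1.map (Function.Embedding.subtype _)) (fun k => e (p.2.getD k 0))
  refine ⟨range y, countable_range y, fun x => ?_⟩
  choose F v l hl hlx using fun n : ℕ =>
    exists_stepPath_dist_lt hD he x n (Nat.one_div_pos_of_nat (n := n) (α := ℝ))
  have hlim := tendsto_one_div_add_atTop_nhds_zero_nat (𝕜 := ℝ)
  refine mem_closure_of_tendsto (tendsto_of_timeChange (x := fun n => y (F n, v n))
    (l := fun n => (l n).symm) (fun n => by positivity) hlim (fun n => (hl n).symm) ?_)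
    (Eventually.of_forall fun n => ⟨_, rfl⟩)
  intro T ε hε
  obtain ⟨N, hN⟩ := exists_nat_ge (Real.exp 1 * T)
  filter_upwards [hlim.eventually_lt_const hε, eventually_ge_atTop N] with n hn hNn t ht
  have h1 : (l n).symm t ≤ n := by
    have h2 := ((hl n).symm.mono (show 1 / ((n : ℝ) + 1) ≤ 1 from
      div_le_one_of_le₀ (by linarith [n.cast_nonneg (α := ℝ)]) (by positivity))).le_exp_mul
      (map_bot _) t
    have h3 : Real.exp 1 * t ≤ Real.exp 1 * T :=
      mul_le_mul_of_nonneg_left (by exact_mod_cast ht) (Real.exp_pos _).le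
    have h4 : (N : ℝ) ≤ n := by exact_mod_cast hNn
    exact_mod_cast (h2.trans (h3.trans (hN.trans h4)))
  have h := hlx n _ h1
  rw [OrderIso.apply_symm_apply] at h
  exact h.trans hn.le

end


/-! ### Killed paths -/

section

variable {E : Type*} [TopologicalSpace E] {x₀ : E}

@[ext]
theorem KilledPath.ext {ω ω' : KilledPath x₀} (h : ∀ t, ω t = ω' t) : ω = ω' := by
  cases ω; cases ω'; congr; exact funext h

theorem eq_cemetery_iff (ω : KilledPath x₀) (t : ℝ≥0) :
    ω t = cemetery ↔ lifetime ω ≤ t := by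
  refine ⟨fun h => iInf₂_le t h, fun h => ?_⟩
  obtain ⟨s, hs⟩ : ∃ s, ω s = cemetery := by
    by_contra! hc
    rw [lifetime] at h
    simp [hc] at h
  rw [← hs]
  exact ω.const' t s h (iInf₂_le s hs)

theorem KilledPath.rightContinuous (ω : KilledPath x₀) (t : ℝ≥0) :
    ContinuousWithinAt ω (Ioi t) t := by
  rcases lt_or_ge (t : ℝ≥0∞) (lifetime ω) with h | h
  · exact (ω.cadlag' t h).1
  · refine tendsto_nhds_of_eventually_eq ?_
    filter_upwards [self_mem_nhdsWithin] with s hs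
    exact ω.const' s t (h.trans (by exact_mod_cast le_of_lt hs)) h

/-- The inverse of `timeScale z` on `[0, z)`; the values at times `t ≥ z` are irrelevant. -/
def timeScaleInv (z : ℝ≥0∞) (t : ℝ≥0) : ℝ≥0 :=
  if z = ∞ then t else (-Real.log (1 - t / z.toReal)).toNNReal

theorem timeScale_timeScaleInv {z : ℝ≥0∞} {t : ℝ≥0} (h : (t : ℝ≥0∞) < z) :
    timeScale z (timeScaleInv z t) = t := by
  unfold timeScale timeScaleInv
  split_ifs with hz
  · rfl
  · lift z to ℝ≥0 using hz
    have htz : t < z := by exact_mod_cast h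
    have hz0 : (0 : ℝ) < z := by exact_mod_cast (zero_le.trans_lt htz)
    have h1 : (t : ℝ) / z < 1 := (div_lt_one hz0).2 (by exact_mod_cast htz)
    have h2 : (0 : ℝ) ≤ t / z := by positivity
    have h3 : 0 ≤ -Real.log (1 - t / z) :=
      neg_nonneg.2 (Real.log_nonpos (by linarith) (by linarith))
    rw [ENNReal.toNNReal_coe, ENNReal.coe_toReal, Real.coe_toNNReal _ h3, neg_neg,
      Real.exp_log (by linarith), sub_sub_cancel]
    refine NNReal.coe_injective ?_
    rw [NNReal.coe_mul, Real.coe_toNNReal _ h2]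
    field_simp

theorem timeScaleInv_timeScale {z : ℝ≥0∞} (hz : 0 < z) (t : ℝ≥0) :
    timeScaleInv z (timeScale z t) = t :=
  (strictMono_timeScale hz).injective (timeScale_timeScaleInv (timeScale_lt hz t))

theorem timeScaleInv_zero {z : ℝ≥0∞} (hz : 0 < z) : timeScaleInv z 0 = 0 := by
  have := timeScaleInv_timeScale hz 0
  rwa [timeScale_zero] at this

theorem continuousAt_timeScaleInv {z : ℝ≥0∞} {t : ℝ≥0} (h : (t : ℝ≥0∞) < z) :
    ContinuousAt (timeScaleInv z) t := by
  unfold timeScaleInv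
  split_ifs with hz
  · exact continuousAt_id
  · lift z to ℝ≥0 using hz
    have htz : t < z := by exact_mod_cast h
    have hz0 : (0 : ℝ) < z := by exact_mod_cast (zero_le.trans_lt htz)
    have h1 : (t : ℝ) / z < 1 := (div_lt_one hz0).2 (by exact_mod_cast htz)
    refine continuous_real_toNNReal.continuousAt.comp (ContinuousAt.neg (ContinuousAt.log ?_ ?_))
    · fun_prop
    · rw [ENNReal.coe_toReal]; linarith

theorem timeScaleInv_lt_timeScaleInv {z : ℝ≥0∞} {s t : ℝ≥0} (hst : s < t)
    (h : (t : ℝ≥0∞) < z) : timeScaleInv z s < timeScaleInv z t := by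
  have hz : 0 < z := zero_le.trans_lt h
  rwa [← (strictMono_timeScale hz).lt_iff_lt, timeScale_timeScaleInv h,
    timeScale_timeScaleInv (lt_trans (by exact_mod_cast hst) h)]

theorem measurable_timeScaleInv (t : ℝ≥0) : Measurable fun z => timeScaleInv z t := by
  unfold timeScaleInv
  refine Measurable.ite (measurableSet_singleton ∞) measurable_const ?_
  fun_prop

/-- The path which runs through `x`, with time rescaled to `[0, z)`, and is killed at time `z`. -/
def killedFun (z : ℝ≥0∞) (x : ℝ≥0 → E) (t : ℝ≥0) : WithCemetery E :=
  if (t : ℝ≥0∞) < z then Sum.inl (x (timeScaleInv z t)) else cemetery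

theorem lifetime_killedFun {F : Type*} (z : ℝ≥0∞) (x : ℝ≥0 → F) : lifetime (killedFun z x) = z := by
  have h : ∀ t, killedFun z x t = cemetery ↔ z ≤ t := fun t => by
    unfold killedFun
    split_ifs with h <;> simpa using h
  simp only [lifetime, h]
  refine le_antisymm (le_of_forall_gt fun c hc => ?_) (le_iInf₂ fun t ht => ht)
  obtain ⟨t, h1, h2⟩ := ENNReal.lt_iff_exists_nnreal_btwn.1 hc
  exact (iInf₂_le t h1.le).trans_lt h2

theorem cadlagAt_killedFun {z : ℝ≥0∞} {x : ℝ≥0 → E} {t : ℝ≥0} (ht : (t : ℝ≥0∞) < z)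
    (hx : CadlagAt x (timeScaleInv z t)) : CadlagAt (killedFun z x) t := by
  have hnear : ∀ᶠ s : ℝ≥0 in 𝓝 t, (s : ℝ≥0∞) < z :=
    (ENNReal.continuous_coe.tendsto t).eventually (Iio_mem_nhds ht)
  obtain ⟨hr, l, hl⟩ := hx
  have hc := (continuousAt_timeScaleInv ht).tendsto
  constructor
  · have h1 : Tendsto (timeScaleInv z) (𝓝[>] t) (𝓝[>] (timeScaleInv z t)) := by
      refine tendsto_nhdsWithin_iff.2 ⟨hc.mono_left nhdsWithin_le_nhds, ?_⟩
      filter_upwards [nhdsWithin_le_nhds hnear, self_mem_nhdsWithin] with s hs hts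
      exact timeScaleInv_lt_timeScaleInv hts hs
    have h2 := (continuous_inl (Y := Unit).tendsto _).comp (hr.tendsto.comp h1)
    have h3 : killedFun z x t = Sum.inl (x (timeScaleInv z t)) := if_pos ht
    rw [ContinuousWithinAt, h3]
    refine h2.congr' ?_
    filter_upwards [nhdsWithin_le_nhds hnear] with s hs
    exact (if_pos hs).symm
  · have h1 : Tendsto (timeScaleInv z) (𝓝[<] t) (𝓝[<] (timeScaleInv z t)) := by
      refine tendsto_nhdsWithin_iff.2 ⟨hc.mono_left nhdsWithin_le_nhds, ?_⟩
      filter_upwards [self_mem_nhdsWithin] with s hst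
      exact timeScaleInv_lt_timeScaleInv hst ht
    refine ⟨Sum.inl l, ((continuous_inl (Y := Unit).tendsto _).comp (hl.comp h1)).congr' ?_⟩
    filter_upwards [nhdsWithin_le_nhds hnear] with s hs
    exact (if_pos hs).symm

/-- The killed path with lifetime `z` whose rescaling to `[0, ∞)` is `x`. -/
def killedPathOf (z : ℝ≥0∞) (hz : 0 < z) (x : SkorokhodPath x₀) : KilledPath x₀ where
  toFun := killedFun z x
  map_zero' := by simp [killedFun, hz, timeScaleInv_zero hz, x.map_zero']
  cadlag' t ht := cadlagAt_killedFun (by rwa [lifetime_killedFun] at ht) (x.cadlag' _)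
  const' s t hs ht := by
    rw [lifetime_killedFun] at hs ht
    simp only [killedFun, if_neg hs.not_gt, if_neg ht.not_gt]

theorem lifetime_killedPathOf (z : ℝ≥0∞) (hz : 0 < z) (x : SkorokhodPath x₀) :
    lifetime (killedPathOf z hz x) = z := lifetime_killedFun z x

theorem rescale_killedPathOf (z : ℝ≥0∞) (hz : 0 < z) (x : SkorokhodPath x₀) :
    rescale (killedPathOf z hz x) = x := by
  ext t
  apply Sum.inl_injective (β := Unit)
  rw [inl_rescale, lifetime_killedPathOf]
  exact (if_pos (timeScale_lt hz t)).trans (by rw [timeScaleInv_timeScale hz])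

theorem KilledPath.apply_eq (ω : KilledPath x₀) (t : ℝ≥0) :
    ω t = if (t : ℝ≥0∞) < lifetime ω then Sum.inl (rescale ω (timeScaleInv (lifetime ω) t))
      else cemetery := by
  split_ifs with h
  · rw [inl_rescale, timeScale_timeScaleInv h]
  · exact (eq_cemetery_iff ω t).2 (not_lt.1 h)

end

section

variable {E : Type*} [MetricSpace E] {x₀ : E}

/-- A killed path, encoded by its inverse lifetime and its rescaling to `[0, ∞)`. -/
def killedPathCode (ω : KilledPath x₀) : WithLp 1 (ℝ≥0 × SkorokhodPath x₀) :=
  WithLp.toLp 1 ((lifetime ω)⁻¹.toNNReal, rescale ω)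

theorem inv_lifetime_ne_top (ω : KilledPath x₀) : (lifetime ω)⁻¹ ≠ ⊤ :=
  ENNReal.inv_ne_top.2 (lifetime_pos ω).ne'

theorem killedPathCode_injective : Function.Injective (killedPathCode (x₀ := x₀)) := by
  intro ω ω' h
  have h1 : (lifetime ω)⁻¹.toNNReal = (lifetime ω')⁻¹.toNNReal := congrArg WithLp.fst h
  have h2 : rescale ω = rescale ω' := congrArg WithLp.snd h
  rw [ENNReal.toNNReal_eq_toNNReal_iff' (inv_lifetime_ne_top ω) (inv_lifetime_ne_top ω'),
    inv_inj] at h1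
  ext t
  rw [ω.apply_eq, ω'.apply_eq, h1, h2]

theorem killedPathCode_surjective : Function.Surjective (killedPathCode (x₀ := x₀)) := by
  intro p
  have hz : (0 : ℝ≥0∞) < ((p.fst : ℝ≥0) : ℝ≥0∞)⁻¹ := ENNReal.inv_pos.2 ENNReal.coe_ne_top
  refine ⟨killedPathOf _ hz p.snd, ?_⟩
  rw [killedPathCode, lifetime_killedPathOf, rescale_killedPathOf, inv_inv, ENNReal.toNNReal_coe]
  rfl

/-- The metric `killedDist`: the sum of the distances of the two components of the code. -/
abbrev killedMetric (x₀ : E) : MetricSpace (KilledPath x₀) :=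
  MetricSpace.induced killedPathCode killedPathCode_injective inferInstance

attribute [local instance] killedMetric

theorem dist_eq_killedDist (ω ω' : KilledPath x₀) : dist ω ω' = killedDist ω ω' := by
  change dist (killedPathCode ω) (killedPathCode ω') = _
  rw [WithLp.prod_dist_eq_add (by simp)]
  simp [killedPathCode, killedDist, SkorokhodPath.dist_eq, NNReal.dist_eq,
    ENNReal.coe_toNNReal_eq_toReal]

theorem isometry_killedPathCode : Isometry (killedPathCode (x₀ := x₀)) :=
  Isometry.of_dist_eq fun _ _ => rfl

theorem completeSpace_killedPath [CompleteSpace E] : CompleteSpace (KilledPath x₀) :=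
  (isometry_killedPathCode.isUniformInducing.completeSpace_congr killedPathCode_surjective).2
    inferInstance

theorem polishSpace_killedPath [CompleteSpace E] [TopologicalSpace.SeparableSpace E] :
    PolishSpace (KilledPath x₀) := by
  have := completeSpace_killedPath (x₀ := x₀)
  have := UniformSpace.secondCountable_of_separable (SkorokhodPath x₀)
  have : SecondCountableTopology (KilledPath x₀) :=
    isometry_killedPathCode.isEmbedding.isInducing.secondCountableTopology
  infer_instance

end


/-! ### The Borel σ-field of the space of killed paths -/

section

variable {E : Type*} [MetricSpace E] {x₀ : E}

theorem isClosed_setOf_forall_mem_Ioo {C : Set E} (hC : IsClosed C) (t v : ℝ≥0) :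
    IsClosed {x : SkorokhodPath x₀ | ∀ s ∈ Ioo t v, x s ∈ C} := by
  refine IsSeqClosed.isClosed fun x y hx hxy s hs => ?_
  rw [← hC.closure_eq]
  refine Metric.mem_closure_iff.2 fun ε hε => ?_
  obtain ⟨δ, hδ, hclose⟩ := exists_dist_lt_of_skorokhodEDist_lt (x₀ := x₀) s
    (isOpen_Ioo.mem_nhds hs) hε
  obtain ⟨n, hn⟩ := ((tendsto_iff_edist_tendsto_0.1 hxy).eventually_lt_const hδ).exists
  rw [edist_comm, SkorokhodPath.edist_eq] at hn
  obtain ⟨r, hr, h⟩ := hclose y (x n) hn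
  exact ⟨x n r, hx n r hr, h⟩

theorem measurable_skorokhodPath_apply [TopologicalSpace.SeparableSpace E] [MeasurableSpace E]
    [BorelSpace E] [MeasurableSpace (SkorokhodPath x₀)] [BorelSpace (SkorokhodPath x₀)]
    (t : ℝ≥0) : Measurable fun x : SkorokhodPath x₀ => x t := by
  have := UniformSpace.secondCountable_of_separable E
  refine measurable_of_isOpen fun G hG => ?_
  have h : (fun x : SkorokhodPath x₀ => x t) ⁻¹' G =
      ⋃ b ∈ {b ∈ TopologicalSpace.countableBasis E | closure b ⊆ G}, ⋃ m : ℕ,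
        {x : SkorokhodPath x₀ | ∀ s ∈ Ioo t (t + 1 / (m + 1)), x s ∈ closure b} := by
    ext x
    simp only [mem_preimage, mem_open_iff_of_rightContinuous dense_univ (x.rightContinuous t) hG,
      mem_iUnion, mem_ofPred_eq, exists_prop, mem_univ, true_imp_iff, mem_Ioo, and_imp]
  rw [h]
  exact MeasurableSet.biUnion ((TopologicalSpace.countable_countableBasis E).mono fun _ h => h.1)
    fun b _ => MeasurableSet.iUnion fun m =>
      (isClosed_setOf_forall_mem_Ioo isClosed_closure _ _).measurableSet

attribute [local instance] killedMetric

theorem continuous_rescale : Continuous (rescale : KilledPath x₀ → SkorokhodPath x₀) :=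
  (WithLp.prod_continuous_ofLp 1 ℝ≥0 (SkorokhodPath x₀)).snd.comp
    isometry_killedPathCode.continuous

theorem continuous_lifetime : Continuous fun ω : KilledPath x₀ => lifetime ω := by
  have h : Continuous fun ω : KilledPath x₀ => ((lifetime ω)⁻¹.toNNReal : ℝ≥0∞) :=
    ENNReal.continuous_coe.comp ((WithLp.prod_continuous_ofLp 1 ℝ≥0 (SkorokhodPath x₀)).fst.comp
      isometry_killedPathCode.continuous)
  refine (continuous_inv.comp h).congr fun ω => ?_
  change ((lifetime ω)⁻¹.toNNReal : ℝ≥0∞)⁻¹ = lifetime ω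
  rw [ENNReal.coe_toNNReal (inv_lifetime_ne_top ω), inv_inv]

theorem measurable_canonicalProcess_borel [TopologicalSpace.SeparableSpace E] (t : ℝ≥0) :
    Measurable[borel (KilledPath x₀), borel (WithCemetery E)] (canonicalProcess x₀ t) := by
  have := UniformSpace.secondCountable_of_separable E
  borelize E (KilledPath x₀) (SkorokhodPath x₀)
  let : MeasurableSpace (WithCemetery E) := borel _
  have : BorelSpace (WithCemetery E) := ⟨rfl⟩
  have h1 : Measurable fun ω : KilledPath x₀ => lifetime ω := continuous_lifetime.measurable
  have h2 : Measurable fun ω : KilledPath x₀ => rescale ω (timeScaleInv (lifetime ω) t) :=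
    measurable_eval_of_rightContinuous (X := fun s ω => rescale ω s)
      (fun s => (measurable_skorokhodPath_apply s).comp continuous_rescale.measurable)
      (fun ω => (rescale ω).rightContinuous) ((measurable_timeScaleInv t).comp h1)
  have h3 : canonicalProcess x₀ t = fun ω : KilledPath x₀ => if (t : ℝ≥0∞) < lifetime ω then
      Sum.inl (rescale ω (timeScaleInv (lifetime ω) t)) else cemetery :=
    funext fun ω => ω.apply_eq t
  rw [h3]
  exact Measurable.ite (measurableSet_lt measurable_const h1)
    (continuous_inl.measurable.comp h2) measurable_const

/-- The coordinates at a countable dense set of times embed the Polish space of killed paths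
measurably and injectively into a countable product. By the Lusin-Souslin theorem, they generate
its Borel σ-field. -/
theorem borel_killedPath_eq [CompleteSpace E] [TopologicalSpace.SeparableSpace E] :
    borel (KilledPath x₀) = canonicalSigma x₀ := by
  have := UniformSpace.secondCountable_of_separable E
  have := polishSpace_killedPath (x₀ := x₀)
  refine le_antisymm ?_ (iSup_le fun t => (measurable_canonicalProcess_borel t).comap_le)
  obtain ⟨D, hDc, hD⟩ := TopologicalSpace.exists_countable_dense ℝ≥0
  have : Countable D := hDc.to_subtype
  borelize (KilledPath x₀)
  let : MeasurableSpace (WithCemetery E) := borel _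
  have : BorelSpace (WithCemetery E) := ⟨rfl⟩
  let f : KilledPath x₀ → D → WithCemetery E := fun ω t => ω t
  have hf : Measurable f := measurable_pi_lambda _ fun t => measurable_canonicalProcess_borel t.1
  have hinj : Function.Injective f := fun ω ω' h => by
    ext t
    exact congrFun (eq_of_rightContinuous_of_dense ω.rightContinuous ω'.rightContinuous hD
      fun s hs => congrFun h ⟨s, hs⟩) t
  have hcomap : MeasurableSpace.comap f MeasurableSpace.pi = borel (KilledPath x₀) :=
    (hf.measurableEmbedding hinj).comap_eq
  rw [← hcomap, MeasurableSpace.pi, MeasurableSpace.comap_iSup]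
  refine iSup_le fun t => ?_
  rw [MeasurableSpace.comap_comp]
  exact le_iSup (fun t => (borel (WithCemetery E)).comap (canonicalProcess x₀ t)) t.1

end


/-! ### Stopped paths and stopping times -/

theorem untopA_min_top (t : ℝ≥0) : (min (t : WithTop ℝ≥0) ⊤).untopA = t := by
  rw [min_top_right]; rfl

theorem untopA_min_coe (t r : ℝ≥0) : (min (t : WithTop ℝ≥0) r).untopA = min t r := by
  rw [← WithTop.coe_min]; rfl

section

variable {E : Type*} [TopologicalSpace E] {x₀ : E}

/-- A path killed before it is stopped is in the cemetery ever after. -/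
theorem stopped_eq_cemetery (ω : KilledPath x₀) {r s : ℝ≥0}
    (h : lifetime (fun t => ω (min t r)) ≤ s) : ω (min s r) = cemetery := by
  obtain ⟨q, hq⟩ : ∃ q, ω (min q r) = cemetery := by
    by_contra! hc
    rw [lifetime] at h
    simp [hc] at h
  have h1 : lifetime ω ≤ lifetime (fun t => ω (min t r)) := le_iInf₂ fun q hq =>
    ((eq_cemetery_iff ω _).1 hq).trans (by exact_mod_cast min_le_left q r)
  have h2 : lifetime ω ≤ r :=
    ((eq_cemetery_iff ω _).1 hq).trans (by exact_mod_cast min_le_right q r)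
  refine (eq_cemetery_iff ω _).2 ?_
  rcases min_choice s r with h3 | h3 <;> rw [h3]
  exacts [h1.trans h, h2]

/-- The path `ω` stopped at time `r`. -/
def stopAt (r : ℝ≥0) (ω : KilledPath x₀) : KilledPath x₀ where
  toFun t := ω (min t r)
  map_zero' := by simp [ω.map_zero']
  cadlag' t ht := by
    refine ⟨rightContinuous_comp ω.rightContinuous (fun _ _ h => min_le_min_right _ h)
      (by fun_prop) t, ?_⟩
    rcases le_or_gt t r with htr | htr
    · have htω : (t : ℝ≥0∞) < lifetime ω := by
        by_contra! hcon
        have h : ω (min t r) = cemetery := by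
          rw [min_eq_left htr]
          exact (eq_cemetery_iff ω t).2 hcon
        exact ht.not_ge (iInf₂_le t h)
      obtain ⟨-, l, hl⟩ := ω.cadlag' t htω
      refine ⟨l, hl.congr' ?_⟩
      filter_upwards [self_mem_nhdsWithin] with s hs
      rw [min_eq_left ((le_of_lt hs).trans htr)]
    · refine ⟨ω r, tendsto_nhds_of_eventually_eq ?_⟩
      filter_upwards [nhdsWithin_le_nhds (Ioi_mem_nhds htr)] with s hs
      rw [min_eq_right (le_of_lt hs)]
  const' s t hs ht := (stopped_eq_cemetery ω hs).trans (stopped_eq_cemetery ω ht).symm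

@[simp]
theorem stopAt_apply (r : ℝ≥0) (ω : KilledPath x₀) (t : ℝ≥0) : stopAt r ω t = ω (min t r) := rfl

/-- The events up to time `t` are the preimages of events under stopping at `t`, as
`B_s ∘ stopAt t = B_{s ∧ t}`. -/
theorem canonicalFiltration_eq_comap (t : ℝ≥0) :
    canonicalFiltration x₀ t = (canonicalSigma x₀).comap (stopAt t) := by
  refine le_antisymm (iSup_le fun s => ?_) ?_
  · have h : canonicalProcess x₀ s = canonicalProcess x₀ s ∘ stopAt t := by
      ext1 ω
      simp [canonicalProcess, min_eq_left s.2.out]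
    change MeasurableSpace.comap (canonicalProcess x₀ s) _ ≤ _
    rw [h, ← MeasurableSpace.comap_comp]
    exact MeasurableSpace.comap_mono
      (le_iSup (fun s => (borel (WithCemetery E)).comap (canonicalProcess x₀ s)) s.1)
  · rw [MeasurableSpace.comap_iSup]
    refine iSup_le fun s => ?_
    rw [MeasurableSpace.comap_comp]
    exact le_iSup (fun s : Iic t => (borel (WithCemetery E)).comap (canonicalProcess x₀ s))
      ⟨min s t, min_le_right s t⟩

/-- Membership in an event of `ℱ_t` depends only on the path up to time `t`. -/
theorem stopAt_mem_iff {t : ℝ≥0} {A : Set (KilledPath x₀)}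
    (hA : MeasurableSet[canonicalFiltration x₀ t] A) (ω : KilledPath x₀) :
    stopAt t ω ∈ A ↔ ω ∈ A := by
  rw [canonicalFiltration_eq_comap] at hA
  obtain ⟨A', -, rfl⟩ := hA
  have : stopAt t (stopAt t ω) = stopAt t ω := by
    ext s; simp
  rw [mem_preimage, mem_preimage, this]

theorem measurableSet_canonicalFiltration_of_stopAt_mem_iff {t : ℝ≥0} {A : Set (KilledPath x₀)}
    (hA : MeasurableSet[canonicalSigma x₀] A) (h : ∀ ω, stopAt t ω ∈ A ↔ ω ∈ A) :
    MeasurableSet[canonicalFiltration x₀ t] A := by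
  rw [canonicalFiltration_eq_comap]
  exact ⟨A, hA, ext h⟩

theorem iSup_canonicalFiltration : ⨆ t, canonicalFiltration x₀ t = canonicalSigma x₀ :=
  le_antisymm (iSup_le (canonicalFiltration x₀).le) (iSup_le fun t => le_iSup_of_le t
    (le_iSup (fun s : Iic t => (borel (WithCemetery E)).comap (canonicalProcess x₀ s))
      ⟨t, mem_Iic.2 le_rfl⟩))

/-- The path `ω` stopped at the time `τ ω`. -/
def stopAtTime (τ : KilledPath x₀ → WithTop ℝ≥0) (ω : KilledPath x₀) : KilledPath x₀ :=
  if τ ω = ⊤ then ω else stopAt (τ ω).untopA ω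

theorem stopAtTime_of_eq_top {τ : KilledPath x₀ → WithTop ℝ≥0} {ω : KilledPath x₀}
    (h : τ ω = ⊤) : stopAtTime τ ω = ω := if_pos h

theorem stopAtTime_of_eq_coe {τ : KilledPath x₀ → WithTop ℝ≥0} {ω : KilledPath x₀} {r : ℝ≥0}
    (h : τ ω = r) : stopAtTime τ ω = stopAt r ω := by
  rw [stopAtTime, h, if_neg WithTop.coe_ne_top]
  rfl

theorem stoppedProcess_canonicalProcess (τ : KilledPath x₀ → WithTop ℝ≥0) (t : ℝ≥0) :
    stoppedProcess (canonicalProcess x₀) τ t = canonicalProcess x₀ t ∘ stopAtTime τ := by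
  ext1 ω
  rcases h : τ ω with _ | r
  · change τ ω = ⊤ at h
    rw [stoppedProcess, h, untopA_min_top, Function.comp_apply, stopAtTime_of_eq_top h]
  · change τ ω = (r : WithTop ℝ≥0) at h
    simp only [stoppedProcess, h, Function.comp_apply, stopAtTime_of_eq_coe h, canonicalProcess,
      stopAt_apply, untopA_min_coe]

theorem generatedSigma_stoppedProcess (τ : KilledPath x₀ → WithTop ℝ≥0) :
    generatedSigma (stoppedProcess (canonicalProcess x₀) τ) =
      (canonicalSigma x₀).comap (stopAtTime τ) := by
  simp only [generatedSigma, stoppedProcess_canonicalProcess, MeasurableSpace.comap_iSup,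
    MeasurableSpace.comap_comp]

/-- An event of `ℱ_τ` is its own preimage under stopping at `τ`: if `τ ω = t`, then neither
`{τ ≤ t}` nor the part of the event in `{τ ≤ t}` distinguishes `ω` from `ω` stopped at `t`. -/
theorem stopAtTime_preimage_eq {τ : KilledPath x₀ → WithTop ℝ≥0}
    (hτ : IsStoppingTime (canonicalFiltration x₀) τ) {A : Set (KilledPath x₀)}
    (hA : MeasurableSet[hτ.measurableSpace] A) : stopAtTime τ ⁻¹' A = A := by
  ext ω
  rw [mem_preimage]
  rcases h : τ ω with _ | t
  · rw [stopAtTime_of_eq_top h]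
  · change τ ω = (t : WithTop ℝ≥0) at h
    rw [stopAtTime_of_eq_coe h]
    have h1 := stopAt_mem_iff (((IsStoppingTime.measurableSet hτ _).1 hA).2 t) ω
    have h2 := stopAt_mem_iff (hτ t) ω
    simp only [mem_inter_iff, mem_ofPred_eq, h, le_refl, iff_true, and_true] at h1 h2
    rwa [and_iff_left h2] at h1

end

section

variable {E : Type*} [MetricSpace E] [TopologicalSpace.SeparableSpace E] {x₀ : E}

/-- The stopped process is `ℱ_τ`-measurable. It is `ℱ`-measurable by right-continuity, and an event
of `ℱ` that is invariant under stopping at `s` belongs to `ℱ_s`. -/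
theorem measurable_stoppedProcess_canonicalProcess {τ : KilledPath x₀ → WithTop ℝ≥0}
    (hτ : IsStoppingTime (canonicalFiltration x₀) τ) (t : ℝ≥0) :
    Measurable[hτ.measurableSpace, borel (WithCemetery E)]
      (stoppedProcess (canonicalProcess x₀) τ t) := by
  have := UniformSpace.secondCountable_of_separable E
  let mF : MeasurableSpace (WithCemetery E) := borel _
  have : BorelSpace (WithCemetery E) := ⟨rfl⟩
  have hσ : Measurable[canonicalSigma x₀] fun ω => (min (t : WithTop ℝ≥0) (τ ω)).untopA := by
    refine @measurable_of_Iic ℝ≥0 _ _ _ _ (canonicalSigma x₀) _ _ _ _ fun s => ?_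
    have h : (fun ω => (min (t : WithTop ℝ≥0) (τ ω)).untopA) ⁻¹' Iic s =
        {_ω | t ≤ s} ∪ {ω | τ ω ≤ s} := by
      ext ω
      rcases h : τ ω with _ | r
      · change τ ω = ⊤ at h
        have h' : ¬ τ ω ≤ s := by rw [h]; exact not_le.2 (WithTop.coe_lt_top s)
        rw [mem_preimage, h, untopA_min_top]
        exact (or_iff_left h').symm
      · change τ ω = (r : WithTop ℝ≥0) at h
        have h' : τ ω ≤ s ↔ r ≤ s := by rw [h]; exact WithTop.coe_le_coe
        rw [mem_preimage, h, untopA_min_coe]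
        exact min_le_iff.trans (or_congr_right h'.symm)
    rw [h]
    exact (MeasurableSet.const _).union ((canonicalFiltration x₀).le s _ (hτ s))
  have hmeas : Measurable[canonicalSigma x₀] (stoppedProcess (canonicalProcess x₀) τ t) :=
    @measurable_eval_of_rightContinuous _ _ (canonicalSigma x₀) _ _ _ _ _ (canonicalProcess x₀)
      (fun s => Measurable.of_comap_le
        (le_iSup (fun s => (borel (WithCemetery E)).comap (canonicalProcess x₀ s)) s))
      (fun ω => ω.rightContinuous) _ hσ
  intro C hC
  rw [IsStoppingTime.measurableSet, iSup_canonicalFiltration]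
  refine ⟨hmeas hC, fun s => measurableSet_canonicalFiltration_of_stopAt_mem_iff
    (MeasurableSet.inter (hmeas hC) ((canonicalFiltration x₀).le s _ (hτ s))) fun ω => ?_⟩
  have h1 := stopAt_mem_iff (hτ s) ω
  rw [mem_inter_iff, mem_inter_iff, h1]
  refine and_congr_left fun h2 => ?_
  -- Once `τ ω = r ≤ s`, stopping at `s` changes neither `τ` nor the path up to `r`.
  obtain ⟨r, hr⟩ := WithTop.ne_top_iff_exists.1
    (ne_top_of_le_ne_top WithTop.coe_ne_top (show τ ω ≤ s from h2))
  have hrs : r ≤ s := by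
    have : τ ω ≤ s := h2
    rw [← hr] at this
    exact_mod_cast this
  have h3 : τ (stopAt s ω) = r :=
    (stopAt_mem_iff ((canonicalFiltration x₀).mono hrs _ (hτ.measurableSet_eq r)) ω).2 hr.symm
  rw [mem_preimage, mem_preimage, stoppedProcess, stoppedProcess, h3, ← hr, untopA_min_coe,
    canonicalProcess, canonicalProcess, stopAt_apply,
    min_eq_left ((min_le_right t r).trans hrs)]

theorem measurableSpace_eq_generatedSigma {τ : KilledPath x₀ → WithTop ℝ≥0}
    (hτ : IsStoppingTime (canonicalFiltration x₀) τ) :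
    hτ.measurableSpace = generatedSigma (stoppedProcess (canonicalProcess x₀) τ) := by
  refine le_antisymm (fun A hA => ?_)
    (iSup_le fun t => (measurable_stoppedProcess_canonicalProcess hτ t).comap_le)
  rw [generatedSigma_stoppedProcess]
  exact ⟨A, hτ.measurableSpace_le _ hA, stopAtTime_preimage_eq hτ hA⟩

theorem countablyGenerated_canonicalSigma [CompleteSpace E] :
    @MeasurableSpace.CountablyGenerated _ (canonicalSigma x₀) := by
  let := killedMetric x₀
  have := polishSpace_killedPath (x₀ := x₀)
  rw [← borel_killedPath_eq]
  borelize (KilledPath x₀)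
  infer_instance

end

end KilledPaths

end

theorem mainTheorem6 {E : Type*} [MetricSpace E] [CompleteSpace E]
    [TopologicalSpace.SeparableSpace E] (x₀ : E) :
    (∃ m : MetricSpace (KilledPaths.KilledPath x₀),
      (∀ ω ω' : KilledPaths.KilledPath x₀, dist ω ω' = KilledPaths.killedDist ω ω') ∧
      CompleteSpace (KilledPaths.KilledPath x₀) ∧
      PolishSpace (KilledPaths.KilledPath x₀) ∧
      borel (KilledPaths.KilledPath x₀) = KilledPaths.canonicalSigma x₀) ∧
    (∀ (τ : KilledPaths.KilledPath x₀ → WithTop ℝ≥0)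
      (hτ : IsStoppingTime (KilledPaths.canonicalFiltration x₀) τ),
      hτ.measurableSpace =
        KilledPaths.generatedSigma (stoppedProcess (KilledPaths.canonicalProcess x₀) τ) ∧
      @MeasurableSpace.CountablyGenerated (KilledPaths.KilledPath x₀) hτ.measurableSpace) := by
  refine ⟨⟨KilledPaths.killedMetric x₀, KilledPaths.dist_eq_killedDist,
    KilledPaths.completeSpace_killedPath, KilledPaths.polishSpace_killedPath,
    KilledPaths.borel_killedPath_eq⟩, fun τ hτ =>
      ⟨KilledPaths.measurableSpace_eq_generatedSigma hτ, ?_⟩⟩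
  rw [KilledPaths.measurableSpace_eq_generatedSigma hτ, KilledPaths.generatedSigma_stoppedProcess]
  exact @MeasurableSpace.CountablyGenerated.comap _ _ (KilledPaths.canonicalSigma x₀)
    KilledPaths.countablyGenerated_canonicalSigma _
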